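/- Let $M_1,M_2$ be smooth manifolds, let $J_i$ be an almost complex structure on $M_i$ (a smooth field of endomorphisms of $TM_i$ with $J_i^2=-\mathrm{Id}$), and let $f:M_1\to M_2$ be a diffeomorphism. A differentiable map $h:(N,A)\to(N',A')$ between manifolds equipped with fields of endomorphisms of their tangent bundles is called $(A,A')$-holomorphic if $A'(h(x))\circ d_xh=d_xh\circ A(x)$ for every $x\in N$. The lift of $f$ to the cotangent bundles is $\widetilde f=(f,{}^t(df)^{-1}):T^*M_1\to T^*M_2$, which sends a covector $\xi$ at $x$ to the covector $\xi\circ(d_xf)^{-1}$ at $f(x)$. For a manifold $M$ with an almost complex structure $J$, let $\pi:T^*M\to M$ be the projection, $\theta_\xi(V)=\xi(d\pi V)$ the Liouville form and $\omega_{st}=d\theta$ the canonical symplectic form on $T^*M$. Let $\theta(J)$ be the one-form $\theta(J)_\xi(V)=\xi(J\,d\pi V)$, and let $J^c$ be the field of endomorphisms of $T(T^*M)$ defined by $d(\theta(J))=\omega_{st}(J^c\cdot,\cdot)$. For a tensor $R$ of type $(1,2)$ on $M$ let $\gamma(R)$ be the field of endomorphisms of $T(T^*M)$ defined by $\omega_{st}(\gamma(R)V,W)=\xi(R(d\pi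 V,d\pi W))$ for $V,W\in T_\xi T^*M$; in local coordinates $(x,p)$, $\gamma(R)=p_kR^k_{i,j}\,dx^i\otimes\partial_{p_j}$. The complete lift of $J$ is $$\widetilde J:=J^c-\tfrac12\gamma(JN_J),\qquad N_J(X,Y)=[JX,JY]-J[X,JY]-J[JX,Y]-[X,Y].$$ For a smooth connection $\nabla$ on $M$ with torsion $T$, let $\widetilde\nabla:=\nabla-\tfrac12T$, $(\widetilde\nabla J)(X,Y):=\widetilde\nabla_X(JY)-J\widetilde\nabla_XY$ and $[\widetilde\nabla J](X,Y):=-(\widetilde\nabla J)(X,Y)+(\widetilde\nabla J)(Y,X)$. The horizontal lift of $J$ is $$J^{H,\nabla}:=J^c+\gamma([\widetilde\nabla J]).$$ Then: (1) $\widetilde f$ is $(\widetilde{J_1},\widetilde{J_2})$-holomorphic if and only if $f$ is $(J_1,J_2)$-holomorphic. (2) For all smooth connections $\nabla_1$ on $M_1$ and $\nabla_2$ on $M_2$, $\widetilde f$ is $(J_1^{H,\nabla_1},J_2^{H,\nabla_2})$-holomorphic if and only if $f$ is $(J_1,J_2)$-holomorphic and $f_*[\widetilde{\nabla_1}J_1]=[\widetilde{\nabla_2}J_2]$,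 where $(f_*R)_y(u,v)=df\big(R(df^{-1}u,df^{-1}v)\big)$, $R$ being taken at $f^{-1}(y)$. -/

import Mathlib

open Bundle Set VectorField
open scoped Manifold ContDiff Topology

noncomputable section

namespace AlmostComplex

/-! ### Almost complex structures

Throughout, a smooth manifold is a manifold `M` without boundary modelled on a finite-dimensional
real vector space `E`, with model `𝓘(ℝ, E)` and of class `C^∞`. -/

/-- An almost complex structure on `M`: a smooth field `J` of endomorphisms of the tangent spaces
with `J² = -Id`. -/
structure AlmostComplexStructure (E : Type*) [NormedAddCommGroup E] [NormedSpace ℝ E]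
    (M : Type*) [TopologicalSpace M] [ChartedSpace E M] [IsManifold 𝓘(ℝ, E) ∞ M] where
  toFun : ∀ x : M, TangentSpace 𝓘(ℝ, E) x →L[ℝ] TangentSpace 𝓘(ℝ, E) x
  smooth : ContMDiff 𝓘(ℝ, E) (𝓘(ℝ, E).prod 𝓘(ℝ, E →L[ℝ] E)) ∞
    (fun x : M ↦ TotalSpace.mk' (E →L[ℝ] E)
      (E := fun x : M ↦ TangentSpace 𝓘(ℝ, E) x →L[ℝ] TangentSpace 𝓘(ℝ, E) x) x (toFun x))
  sq : ∀ (x : M) (v : TangentSpace 𝓘(ℝ, E) x), toFun x (toFun x v) = -v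

/-- A map `f` between manifolds carrying fields of tangent endomorphisms `J`, `J'` is
`(J, J')`-holomorphic if it is differentiable and `J' (f x) ∘ d_x f = d_x f ∘ J x` for all `x`. -/
def IsHolomorphic {E H E' H' : Type*}
    [NormedAddCommGroup E] [NormedSpace ℝ E] [TopologicalSpace H] (I : ModelWithCorners ℝ E H)
    [NormedAddCommGroup E'] [NormedSpace ℝ E'] [TopologicalSpace H'] (I' : ModelWithCorners ℝ E' H')
    {N N' : Type*} [TopologicalSpace N] [ChartedSpace H N] [TopologicalSpace N']
    [ChartedSpace H' N']
    (J : ∀ x : N, TangentSpace I x →L[ℝ] TangentSpace I x)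
    (J' : ∀ y : N', TangentSpace I' y →L[ℝ] TangentSpace I' y) (f : N → N') : Prop :=
  MDifferentiable I I' f ∧ ∀ x : N, (J' (f x)) ∘L (mfderiv I I' f x) = (mfderiv I I' f x) ∘L (J x)

section

variable {E H : Type*} [NormedAddCommGroup E] [NormedSpace ℝ E] [TopologicalSpace H]
  (I : ModelWithCorners ℝ E H) {N : Type*} [TopologicalSpace N] [ChartedSpace H N]

/-- The one-form `α` on `N` in the chart `φ` at `p`, that is, `(φ⁻¹)^* α`. -/
def chartForm (α : ∀ q : N, TangentSpace I q →L[ℝ] ℝ) (p : N) (y : E) : E →L[ℝ] ℝ :=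
  (α ((extChartAt I p).symm y)) ∘L (mfderiv 𝓘(ℝ, E) I (extChartAt I p).symm y)

/-- The differential at `p` of the chart `φ` at `p`. -/
def dChart (p : N) : TangentSpace I p →L[ℝ] E := mfderiv I 𝓘(ℝ, E) (extChartAt I p) p

/-- The exterior derivative of a one-form `α` on a manifold without boundary, computed in the
chart `φ` at `p`: if `β = (φ⁻¹)^* α` and `D β` is its derivative at `φ p`, then
`(dα)_p (u, v) = (D β (dφ u)) (dφ v) - (D β (dφ v)) (dφ u)`. -/
def extDerivOne [I.Boundaryless] (α : ∀ q : N, TangentSpace I q →L[ℝ] ℝ) (p : N) :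
    TangentSpace I p →L[ℝ] TangentSpace I p →L[ℝ] ℝ :=
  (ContinuousLinearMap.precomp ℝ (dChart I p)) ∘L
    (fderiv ℝ (chartForm I α p) (extChartAt I p p) -
      (fderiv ℝ (chartForm I α p) (extChartAt I p p)).flip) ∘L dChart I p

lemma extDerivOne_apply [I.Boundaryless] (α : ∀ q : N, TangentSpace I q →L[ℝ] ℝ) (p : N)
    (u v : TangentSpace I p) :
    extDerivOne I α p u v =
      fderiv ℝ (chartForm I α p) (extChartAt I p p) (dChart I p u) (dChart I p v) -
        fderiv ℝ (chartForm I α p) (extChartAt I p p) (dChart I p v) (dChart I p u) := rfl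

end

section

variable {E : Type*} [NormedAddCommGroup E] [NormedSpace ℝ E]
  {M : Type*} [TopologicalSpace M] [ChartedSpace E M] [IsManifold 𝓘(ℝ, E) ∞ M]

/-! ### The cotangent bundle and its canonical forms -/

/-- The cotangent space `T_x^* M`. -/
abbrev CotangentSpace (E : Type*) [NormedAddCommGroup E] [NormedSpace ℝ E]
    {M : Type*} [TopologicalSpace M] [ChartedSpace E M] (x : M) : Type _ :=
  TangentSpace 𝓘(ℝ, E) x →L[ℝ] Bundle.Trivial M ℝ x

/-- The cotangent bundle `T^* M`, with Mathlib's manifold structure on the total space of a smooth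
vector bundle. -/
abbrev CotangentBundle (E : Type*) [NormedAddCommGroup E] [NormedSpace ℝ E]
    (M : Type*) [TopologicalSpace M] [ChartedSpace E M] : Type _ :=
  TotalSpace (E →L[ℝ] ℝ) (fun x : M ↦ CotangentSpace E x)

/-- The model with corners of the manifold `T^* M`. -/
abbrev cotangentModel (E : Type*) [NormedAddCommGroup E] [NormedSpace ℝ E] :
    ModelWithCorners ℝ (E × (E →L[ℝ] ℝ)) (ModelProd E (E →L[ℝ] ℝ)) :=
  𝓘(ℝ, E).prod 𝓘(ℝ, E →L[ℝ] ℝ)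

/-- The differential `d_ξ π` of the projection `π : T^* M → M`. -/
def dProj (ξ : CotangentBundle E M) :
    TangentSpace (cotangentModel E) ξ →L[ℝ] TangentSpace 𝓘(ℝ, E) ξ.proj :=
  mfderiv (cotangentModel E) 𝓘(ℝ, E) (fun η : CotangentBundle E M ↦ η.proj) ξ

/-- The covector `ξ ∈ T_x^* M` as a linear form on `T_x M`. -/
def covector (ξ : CotangentBundle E M) : TangentSpace 𝓘(ℝ, E) ξ.proj →L[ℝ] ℝ := ξ.2

/-- The Liouville form `θ_ξ(V) = ξ (dπ V)`, locally `p_i dx^i`. -/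
def liouville (ξ : CotangentBundle E M) : TangentSpace (cotangentModel E) ξ →L[ℝ] ℝ :=
  covector ξ ∘L dProj ξ

/-- The canonical symplectic form `ω_st = dθ`, as the map `V ↦ ω_st(V, ·)`. -/
def omegaSt (ξ : CotangentBundle E M) :
    TangentSpace (cotangentModel E) ξ →L[ℝ] TangentSpace (cotangentModel E) ξ →L[ℝ] ℝ :=
  extDerivOne (cotangentModel E) liouville ξ

/-! The form `ω_st` is nondegenerate: in the canonical coordinates `(x, p)` it is
`(u, v) ↦ p(u) (x(v)) - p(v) (x(u))`. -/

lemma mdifferentiable_proj :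
    MDifferentiable (cotangentModel E) 𝓘(ℝ, E) (fun η : CotangentBundle E M ↦ η.proj) :=
  (Bundle.contMDiff_proj (n := ∞) (IB := 𝓘(ℝ, E)) (F := E →L[ℝ] ℝ)
    (fun x : M ↦ CotangentSpace E x)).mdifferentiable (by simp)

lemma extChartAt_cotangent_snd (ξ η : CotangentBundle E M)
    (h : η.proj ∈ (chartAt E ξ.proj).source) :
    (extChartAt (cotangentModel E) ξ η).2 =
      covector η ∘L (mfderiv 𝓘(ℝ, E) 𝓘(ℝ, E) (extChartAt 𝓘(ℝ, E) ξ.proj).symm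
        (extChartAt 𝓘(ℝ, E) ξ.proj η.proj)) := by
  rw [← mfderivWithin_univ, ← ModelWithCorners.range_eq_univ 𝓘(ℝ, E),
    ← TangentBundle.symmL_trivializationAt h, FiberBundle.extChartAt]
  simp [hom_trivializationAt, Trivialization.continuousLinearMap_apply]
  rfl

lemma extChartAt_cotangent_fst (ξ η : CotangentBundle E M) :
    (extChartAt (cotangentModel E) ξ η).1 = extChartAt 𝓘(ℝ, E) ξ.proj η.proj := by
  rw [FiberBundle.extChartAt]
  rfl

lemma chartForm_liouville (ξ : CotangentBundle E M) {y : E × (E →L[ℝ] ℝ)}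
    (hy : y ∈ (extChartAt (cotangentModel E) ξ).target) :
    chartForm (cotangentModel E) liouville ξ y =
      y.2 ∘L ContinuousLinearMap.fst ℝ E (E →L[ℝ] ℝ) := by
  rw [chartForm]
  set φ := extChartAt (cotangentModel E) ξ with hφ
  have hs : ∀ z ∈ φ.target, (φ.symm z).proj = (extChartAt 𝓘(ℝ, E) ξ.proj).symm z.1 ∧
      (φ.symm z).proj ∈ (chartAt E ξ.proj).source := by
    intro z hz
    have h1 := φ.map_target hz
    have h2 : (φ.symm z).proj ∈ (chartAt E ξ.proj).source := by
      rw [hφ, extChartAt_source, FiberBundle.chartedSpace_chartAt] at h1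
      simp only [mfld_simps] at h1
      exact h1.1.1
    refine ⟨?_, h2⟩
    have h3 := extChartAt_cotangent_fst ξ (φ.symm z)
    rw [← hφ, φ.right_inv hz] at h3
    rw [h3, (extChartAt 𝓘(ℝ, E) ξ.proj).left_inv (by simpa using h2)]
  have hto : IsOpen φ.target := isOpen_extChartAt_target ξ
  have hd : MDifferentiableAt 𝓘(ℝ, E × (E →L[ℝ] ℝ)) (cotangentModel E) φ.symm y := by
    have := mdifferentiableWithinAt_extChartAt_symm (I := cotangentModel E) (x := ξ) hy
    rwa [ModelWithCorners.range_eq_univ, mdifferentiableWithinAt_univ] at this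
  have hy1 : y.1 ∈ (extChartAt 𝓘(ℝ, E) ξ.proj).target := by
    have h3 := extChartAt_cotangent_fst ξ (φ.symm y)
    rw [← hφ, φ.right_inv hy] at h3
    rw [h3]
    exact (extChartAt 𝓘(ℝ, E) ξ.proj).map_source (by simpa using (hs y hy).2)
  have hd1 : MDifferentiableAt 𝓘(ℝ, E) 𝓘(ℝ, E) (extChartAt 𝓘(ℝ, E) ξ.proj).symm y.1 := by
    have := mdifferentiableWithinAt_extChartAt_symm (I := 𝓘(ℝ, E)) (x := ξ.proj) hy1
    rwa [ModelWithCorners.range_eq_univ, mdifferentiableWithinAt_univ] at this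
  have hfst : HasMFDerivAt 𝓘(ℝ, E × (E →L[ℝ] ℝ)) 𝓘(ℝ, E) (Prod.fst : E × (E →L[ℝ] ℝ) → E) y
      (ContinuousLinearMap.fst ℝ E (E →L[ℝ] ℝ)) := hasFDerivAt_fst.hasMFDerivAt
  have e1 : HasMFDerivAt 𝓘(ℝ, E × (E →L[ℝ] ℝ)) 𝓘(ℝ, E)
      ((fun η : CotangentBundle E M ↦ η.proj) ∘ φ.symm) y
      (dProj (φ.symm y) ∘L mfderiv 𝓘(ℝ, E × (E →L[ℝ] ℝ)) (cotangentModel E) φ.symm y) :=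
    (mdifferentiable_proj _).hasMFDerivAt.comp y hd.hasMFDerivAt
  have e2 : HasMFDerivAt 𝓘(ℝ, E × (E →L[ℝ] ℝ)) 𝓘(ℝ, E)
      ((extChartAt 𝓘(ℝ, E) ξ.proj).symm ∘ Prod.fst) y
      (mfderiv 𝓘(ℝ, E) 𝓘(ℝ, E) (extChartAt 𝓘(ℝ, E) ξ.proj).symm y.1 ∘L
        ContinuousLinearMap.fst ℝ E (E →L[ℝ] ℝ)) :=
    hd1.hasMFDerivAt.comp y hfst
  have e3 := hasMFDerivAt_unique e1 (e2.congr_of_eventuallyEq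
    (Filter.eventuallyEq_of_mem (hto.mem_nhds hy) fun z hz ↦ (hs z hz).1))
  have e4 := extChartAt_cotangent_snd ξ (φ.symm y) (hs y hy).2
  have e5 : extChartAt 𝓘(ℝ, E) ξ.proj (φ.symm y).proj = y.1 := by
    rw [← extChartAt_cotangent_fst, ← hφ, φ.right_inv hy]
  rw [e5, ← hφ, φ.right_inv hy] at e4
  ext v
  · exact (congr(covector (φ.symm y) ($e3 (v, 0)))).trans congr($e4.symm v)
  · exact (congr(covector (φ.symm y) ($e3 (0, v)))).trans congr($e4.symm 0)

lemma fderiv_comp_fst {F G : Type*} [NormedAddCommGroup F] [NormedSpace ℝ F]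
    [NormedAddCommGroup G] [NormedSpace ℝ G] (c : G →L[ℝ] F →L[ℝ] ℝ)
    (β : F × G → F × G →L[ℝ] ℝ) (p : F × G)
    (h : ∀ᶠ y in 𝓝 p, β y = c y.2 ∘L ContinuousLinearMap.fst ℝ F G) (u v : F × G) :
    fderiv ℝ β p u v = c u.2 v.1 := by
  let L : F × G →L[ℝ] F × G →L[ℝ] ℝ :=
    ((ContinuousLinearMap.compL ℝ (F × G) F ℝ).flip (ContinuousLinearMap.fst ℝ F G)) ∘L
      c ∘L ContinuousLinearMap.snd ℝ F G
  have hL : β =ᶠ[𝓝 p] L := h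
  rw [(L.hasFDerivAt.congr_of_eventuallyEq hL).fderiv]
  rfl

lemma fderiv_snd_comp_fst {F : Type*} [NormedAddCommGroup F] [NormedSpace ℝ F]
    (β : F × (F →L[ℝ] ℝ) → F × (F →L[ℝ] ℝ) →L[ℝ] ℝ) (p : F × (F →L[ℝ] ℝ))
    (h : ∀ᶠ y in 𝓝 p, β y = y.2 ∘L ContinuousLinearMap.fst ℝ F (F →L[ℝ] ℝ))
    (u v : F × (F →L[ℝ] ℝ)) : fderiv ℝ β p u v = u.2 v.1 :=
  fderiv_comp_fst (.id ℝ (F →L[ℝ] ℝ)) β p h u v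

lemma omegaSt_apply (ξ : CotangentBundle E M) (u v : TangentSpace (cotangentModel E) ξ) :
    omegaSt ξ u v =
      (dChart (cotangentModel E) ξ u).2 (dChart (cotangentModel E) ξ v).1 -
        (dChart (cotangentModel E) ξ v).2 (dChart (cotangentModel E) ξ u).1 := by
  have h := fderiv_snd_comp_fst (chartForm (cotangentModel E) liouville ξ)
    (extChartAt (cotangentModel E) ξ ξ) (Filter.eventually_of_mem (extChartAt_target_mem_nhds ξ)
      fun y hy ↦ chartForm_liouville ξ hy)
  rw [omegaSt, extDerivOne_apply, h, h]

lemma omegaSt_isInvertible [FiniteDimensional ℝ E] (ξ : CotangentBundle E M) :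
    (omegaSt ξ).IsInvertible := by
  have : FiniteDimensional ℝ (TangentSpace (cotangentModel E) ξ) :=
    inferInstanceAs (FiniteDimensional ℝ (E × (E →L[ℝ] ℝ)))
  have : T2Space (TangentSpace (cotangentModel E) ξ) :=
    inferInstanceAs (T2Space (E × (E →L[ℝ] ℝ)))
  obtain ⟨e, he⟩ : (dChart (cotangentModel E) ξ).IsInvertible :=
    isInvertible_mfderiv_extChartAt (mem_extChartAt_source (I := cotangentModel E) ξ)
  have hinj : Function.Injective (omegaSt ξ).toLinearMap := by
    rw [injective_iff_map_eq_zero]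
    intro u hu
    have h : ∀ w : E × (E →L[ℝ] ℝ),
        (e u : E × (E →L[ℝ] ℝ)).2 w.1 - w.2 (e u : E × (E →L[ℝ] ℝ)).1 = 0 := by
      intro w
      have h1 := omegaSt_apply ξ u (e.symm w)
      have h2 : omegaSt ξ u (e.symm w) = 0 := congr($hu (e.symm w))
      have h3 : e (e.symm w) = w := e.apply_symm_apply w
      rw [h2, ← he] at h1
      simp only [ContinuousLinearEquiv.coe_coe] at h1
      rw [h3] at h1
      exact h1.symm
    have h1 : (e u : E × (E →L[ℝ] ℝ)).2 = 0 := by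
      ext a
      simpa using h (a, 0)
    have h2 : (e u : E × (E →L[ℝ] ℝ)).1 = 0 := by
      refine SeparatingDual.eq_zero_of_forall_dual_eq_zero (R := ℝ) fun g ↦ ?_
      simpa using h (0, g)
    exact e.map_eq_zero_iff.1 (Prod.ext h2 h1)
  have hdim : Module.finrank ℝ (TangentSpace (cotangentModel E) ξ) =
      Module.finrank ℝ (TangentSpace (cotangentModel E) ξ →L[ℝ] ℝ) := by
    rw [← (LinearMap.toContinuousLinearMap (𝕜 := ℝ) (E := TangentSpace (cotangentModel E) ξ)
      (F' := ℝ)).finrank_eq]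
    exact Subspace.dual_finrank_eq.symm
  exact ⟨(LinearEquiv.ofInjectiveOfFinrankEq _ hinj hdim).toContinuousLinearEquiv, by ext; rfl⟩

/-! ### The tensors `θ(A)`, `θ(R)` and duality by `ω_st` -/

/-- The one-form `θ(A)` on `T^* M` of a field `A` of endomorphisms:
`θ(A)_ξ(V) = ξ (A (dπ V))`, locally `p_k A^k_l dx^l`. -/
def theta₁ (A : ∀ x : M, TangentSpace 𝓘(ℝ, E) x →L[ℝ] TangentSpace 𝓘(ℝ, E) x)
    (ξ : CotangentBundle E M) : TangentSpace (cotangentModel E) ξ →L[ℝ] ℝ :=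
  covector ξ ∘L A ξ.proj ∘L dProj ξ

/-- The covariant two-tensor `θ(R)` on `T^* M` of a tensor `R` of type `(1,2)`:
`θ(R)_ξ(V, W) = ξ (R (dπ V, dπ W))`, locally `p_k R^k_{ij} dx^i ⊗ dx^j`. -/
def theta₂ (R : ∀ x : M, TangentSpace 𝓘(ℝ, E) x →L[ℝ]
      TangentSpace 𝓘(ℝ, E) x →L[ℝ] TangentSpace 𝓘(ℝ, E) x)
    (ξ : CotangentBundle E M) :
    TangentSpace (cotangentModel E) ξ →L[ℝ] TangentSpace (cotangentModel E) ξ →L[ℝ] ℝ :=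
  (ContinuousLinearMap.precomp ℝ (dProj ξ)) ∘L
    (ContinuousLinearMap.postcomp (TangentSpace 𝓘(ℝ, E) ξ.proj) (covector ξ)) ∘L
      R ξ.proj ∘L dProj ξ

lemma theta₂_apply (R : ∀ x : M, TangentSpace 𝓘(ℝ, E) x →L[ℝ]
      TangentSpace 𝓘(ℝ, E) x →L[ℝ] TangentSpace 𝓘(ℝ, E) x)
    (ξ : CotangentBundle E M) (V W : TangentSpace (cotangentModel E) ξ) :
    theta₂ R ξ V W = covector ξ (R ξ.proj (dProj ξ V) (dProj ξ W)) := rfl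

/-- The endomorphism `A` of `T_ξ T^* M` with `ω_st(A V, W) = B(V, W)` for all `V`, `W`, which
exists and is unique since `ω_st` is nondegenerate. -/
def omegaSolve (ξ : CotangentBundle E M)
    (B : TangentSpace (cotangentModel E) ξ →L[ℝ] TangentSpace (cotangentModel E) ξ →L[ℝ] ℝ) :
    TangentSpace (cotangentModel E) ξ →L[ℝ] TangentSpace (cotangentModel E) ξ :=
  (omegaSt ξ).inverse ∘L B

lemma omegaSt_omegaSolve [FiniteDimensional ℝ E] (ξ : CotangentBundle E M)
    (B : TangentSpace (cotangentModel E) ξ →L[ℝ] TangentSpace (cotangentModel E) ξ →L[ℝ] ℝ)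
    (V W : TangentSpace (cotangentModel E) ξ) : omegaSt ξ (omegaSolve ξ B V) W = B V W := by
  obtain ⟨e, he⟩ := omegaSt_isInvertible ξ
  rw [omegaSolve, ← he, ContinuousLinearMap.inverse_equiv]
  exact congr($(e.apply_symm_apply (B V)) W)

/-! ### Tensors on an almost complex manifold -/

/-- The tensor `(X, Y) ↦ R(Y, X)`. -/
def flipTensor {x : M} (R : TangentSpace 𝓘(ℝ, E) x →L[ℝ]
      TangentSpace 𝓘(ℝ, E) x →L[ℝ] TangentSpace 𝓘(ℝ, E) x) :
    TangentSpace 𝓘(ℝ, E) x →L[ℝ] TangentSpace 𝓘(ℝ, E) x →L[ℝ] TangentSpace 𝓘(ℝ, E) x :=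
  ContinuousLinearMap.flip (E := E) (F := E) (G := E) R

@[simp]
lemma flipTensor_apply {x : M} (R : TangentSpace 𝓘(ℝ, E) x →L[ℝ]
      TangentSpace 𝓘(ℝ, E) x →L[ℝ] TangentSpace 𝓘(ℝ, E) x) (u v : TangentSpace 𝓘(ℝ, E) x) :
    flipTensor R u v = R v u := rfl

lemma AlmostComplexStructure.mdiffAt (J : AlmostComplexStructure E M)
    {X : ∀ x : M, TangentSpace 𝓘(ℝ, E) x} {x : M} (hX : MDiffAt (T% X) x) :
    MDiffAt (T% (fun y ↦ J.toFun y (X y))) x := by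
  have h := (J.smooth x).mdifferentiableAt (by simp)
  exact MDifferentiableAt.clm_bundle_apply h hX

/-- The expression `[JX, JY] - J[X, JY] - J[JX, Y] - [X, Y]` for two vector fields. -/
def nijenhuisAux (J : AlmostComplexStructure E M) (X Y : ∀ x : M, TangentSpace 𝓘(ℝ, E) x)
    (x : M) : TangentSpace 𝓘(ℝ, E) x :=
  mlieBracket 𝓘(ℝ, E) (fun y ↦ J.toFun y (X y)) (fun y ↦ J.toFun y (Y y)) x
    - J.toFun x (mlieBracket 𝓘(ℝ, E) X (fun y ↦ J.toFun y (Y y)) x)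
    - J.toFun x (mlieBracket 𝓘(ℝ, E) (fun y ↦ J.toFun y (X y)) Y x)
    - mlieBracket 𝓘(ℝ, E) X Y x

lemma nijenhuisAux_swap (J : AlmostComplexStructure E M) (X Y : ∀ x : M, TangentSpace 𝓘(ℝ, E) x)
    (x : M) : nijenhuisAux J X Y x = - nijenhuisAux J Y X x := by
  simp only [nijenhuisAux]
  rw [mlieBracket_swap_apply, mlieBracket_swap_apply (V := X), mlieBracket_swap_apply (V := X),
    mlieBracket_swap_apply (V := fun y ↦ J.toFun y (X y)) (W := Y)]
  simp
  module

variable [FiniteDimensional ℝ E]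

lemma nijenhuisAux_tensorial_left (J : AlmostComplexStructure E M) (x : M)
    (Y : ∀ x : M, TangentSpace 𝓘(ℝ, E) x) :
    TensorialAt 𝓘(ℝ, E) E (nijenhuisAux J · Y x) x where
  smul {f X} hf hX := by
    have e : (fun y ↦ J.toFun y ((f • X) y)) = f • (fun y ↦ J.toFun y (X y)) := by
      ext y; simp
    simp only [nijenhuisAux, e, mlieBracket_smul_left hf hX, mlieBracket_smul_left hf (J.mdiffAt hX)]
    simp [J.sq]
    module
  add {X X'} hX hX' := by
    have e : (fun y ↦ J.toFun y ((X + X') y))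
        = (fun y ↦ J.toFun y (X y)) + (fun y ↦ J.toFun y (X' y)) := by
      ext y; simp
    simp only [nijenhuisAux, e, mlieBracket_add_left hX hX',
      mlieBracket_add_left (J.mdiffAt hX) (J.mdiffAt hX')]
    simp
    module

lemma nijenhuisAux_tensorial_right (J : AlmostComplexStructure E M) (x : M)
    (X : ∀ x : M, TangentSpace 𝓘(ℝ, E) x) :
    TensorialAt 𝓘(ℝ, E) E (nijenhuisAux J X · x) x where
  smul {f Y} hf hY := by
    simp only [nijenhuisAux_swap J X]
    rw [(nijenhuisAux_tensorial_left J x X).smul hf hY]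
    simp
  add {Y Y'} hY hY' := by
    simp only [nijenhuisAux_swap J X]
    rw [(nijenhuisAux_tensorial_left J x X).add hY hY']
    module

/-- The Nijenhuis tensor `N_J(X, Y) = [JX, JY] - J[X, JY] - J[JX, Y] - [X, Y]`. -/
def nijenhuis (J : AlmostComplexStructure E M) (x : M) :
    TangentSpace 𝓘(ℝ, E) x →L[ℝ] TangentSpace 𝓘(ℝ, E) x →L[ℝ] TangentSpace 𝓘(ℝ, E) x :=
  TensorialAt.mkHom₂ (nijenhuisAux J · · x) x
    (fun Y _ ↦ nijenhuisAux_tensorial_left J x Y) (fun X _ ↦ nijenhuisAux_tensorial_right J x X)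

/-- The tensor `J N_J`. -/
def complexNijenhuis (J : AlmostComplexStructure E M) (x : M) :
    TangentSpace 𝓘(ℝ, E) x →L[ℝ] TangentSpace 𝓘(ℝ, E) x →L[ℝ] TangentSpace 𝓘(ℝ, E) x :=
  (ContinuousLinearMap.postcomp (TangentSpace 𝓘(ℝ, E) x) (J.toFun x)) ∘L nijenhuis J x

/-- A connection on `M`: a covariant derivative on `TM`, where `D Y x (X x)` is `(∇_X Y)(x)`. -/
abbrev Connection (E : Type*) [NormedAddCommGroup E] [NormedSpace ℝ E]
    (M : Type*) [TopologicalSpace M] [ChartedSpace E M] [IsManifold 𝓘(ℝ, E) ∞ M] : Type _ :=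
  CovariantDerivative 𝓘(ℝ, E) E (fun x : M ↦ TangentSpace 𝓘(ℝ, E) x)

/-- The symmetrized connection `∇ - T/2`, where `T` is the torsion of `∇`. -/
def symmetrized (D : Connection E M) : Connection E M :=
  D.addOneForm (fun x ↦ -(1 / 2 : ℝ) • flipTensor (D.torsion x))

/-- For a vector field `Y`, the endomorphism `X ↦ ∇_X (JY) - J ∇_X Y`. -/
def nablaAux (D : Connection E M) (J : AlmostComplexStructure E M)
    (Y : ∀ x : M, TangentSpace 𝓘(ℝ, E) x) (x : M) :
    TangentSpace 𝓘(ℝ, E) x →L[ℝ] TangentSpace 𝓘(ℝ, E) x :=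
  D (fun y ↦ J.toFun y (Y y)) x - J.toFun x ∘L D Y x

lemma nablaAux_tensorial (D : Connection E M) (J : AlmostComplexStructure E M) (x : M) :
    TensorialAt 𝓘(ℝ, E) E (nablaAux D J · x) x where
  smul {f Y} hf hY := by
    have e : (fun y ↦ J.toFun y ((f • Y) y)) = f • (fun y ↦ J.toFun y (Y y)) := by
      ext y; simp
    ext v
    simp only [nablaAux]
    rw [e, D.isCovariantDerivativeOnUniv.leibniz hY hf,
      D.isCovariantDerivativeOnUniv.leibniz (J.mdiffAt hY) hf]
    simp
    module
  add {Y Y'} hY hY' := by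
    have e : (fun y ↦ J.toFun y ((Y + Y') y))
        = (fun y ↦ J.toFun y (Y y)) + (fun y ↦ J.toFun y (Y' y)) := by
      ext y; simp
    ext v
    simp only [nablaAux]
    rw [e, D.isCovariantDerivativeOnUniv.add hY hY',
      D.isCovariantDerivativeOnUniv.add (J.mdiffAt hY) (J.mdiffAt hY')]
    simp
    module

/-- The tensor `(∇J)(X, Y) = ∇_X (JY) - J ∇_X Y`. -/
def nablaJ (D : Connection E M) (J : AlmostComplexStructure E M) (x : M) :
    TangentSpace 𝓘(ℝ, E) x →L[ℝ] TangentSpace 𝓘(ℝ, E) x →L[ℝ] TangentSpace 𝓘(ℝ, E) x :=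
  flipTensor (TensorialAt.mkHom (nablaAux D J · x) x (nablaAux_tensorial D J x))

/-- The tensor `(X, Y) ↦ -(∇J)(X, Y) + (∇J)(Y, X)`. -/
def bracketJ (D : Connection E M) (J : AlmostComplexStructure E M) (x : M) :
    TangentSpace 𝓘(ℝ, E) x →L[ℝ] TangentSpace 𝓘(ℝ, E) x →L[ℝ] TangentSpace 𝓘(ℝ, E) x :=
  -nablaJ D J x + flipTensor (nablaJ D J x)

/-! ### Lifts to the cotangent bundle -/

/-- The contraction `γ(R)` of a tensor of type `(1,2)`: the field of endomorphisms of `T T^* M` with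
`ω_st(γ(R) V, W) = θ(R)(V, W)`; in coordinates `γ(R) = p_k R^k_{ij} dx^i ⊗ ∂/∂p_j`. -/
def gamma (R : ∀ x : M, TangentSpace 𝓘(ℝ, E) x →L[ℝ]
      TangentSpace 𝓘(ℝ, E) x →L[ℝ] TangentSpace 𝓘(ℝ, E) x)
    (ξ : CotangentBundle E M) :
    TangentSpace (cotangentModel E) ξ →L[ℝ] TangentSpace (cotangentModel E) ξ :=
  omegaSolve ξ (theta₂ R ξ)

/-- The field `J^c` of endomorphisms of `T T^* M` with `d(θ(J)) = ω_st(J^c ·, ·)`. -/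
def basicLift (J : AlmostComplexStructure E M) (ξ : CotangentBundle E M) :
    TangentSpace (cotangentModel E) ξ →L[ℝ] TangentSpace (cotangentModel E) ξ :=
  omegaSolve ξ (extDerivOne (cotangentModel E) (theta₁ J.toFun) ξ)

/-- The complete lift `J^c - γ(J N_J) / 2` of `J`. -/
def completeLift (J : AlmostComplexStructure E M) (ξ : CotangentBundle E M) :
    TangentSpace (cotangentModel E) ξ →L[ℝ] TangentSpace (cotangentModel E) ξ :=
  basicLift J ξ - (1 / 2 : ℝ) • gamma (complexNijenhuis J) ξ

/-- The horizontal lift `J^{H,∇} = J^c + γ([∇'J])`, where `∇' = ∇ - T/2`. -/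
def horizontalLift (J : AlmostComplexStructure E M) (D : Connection E M)
    (ξ : CotangentBundle E M) :
    TangentSpace (cotangentModel E) ξ →L[ℝ] TangentSpace (cotangentModel E) ξ :=
  basicLift J ξ + gamma (bracketJ (symmetrized D) J) ξ

end

/-! ### Diffeomorphisms -/

section

variable {E₁ E₂ : Type*} [NormedAddCommGroup E₁] [NormedSpace ℝ E₁]
  [NormedAddCommGroup E₂] [NormedSpace ℝ E₂]
  {M₁ M₂ : Type*} [TopologicalSpace M₁] [ChartedSpace E₁ M₁]
  [TopologicalSpace M₂] [ChartedSpace E₂ M₂]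

/-- The lift `(f, ᵗ(df)⁻¹)` of a diffeomorphism `f` to the cotangent bundles:
a covector `ξ` at `x` is sent to the covector `ξ ∘ (d_x f)⁻¹` at `f x`. -/
def cotangentLift (f : M₁ ≃ₘ^∞⟮𝓘(ℝ, E₁), 𝓘(ℝ, E₂)⟯ M₂) (ξ : CotangentBundle E₁ M₁) :
    CotangentBundle E₂ M₂ :=
  ⟨f ξ.proj, covector ξ ∘L
    ((f.mfderivToContinuousLinearEquiv (by simp) ξ.proj).symm :
      TangentSpace 𝓘(ℝ, E₂) (f ξ.proj) →L[ℝ] TangentSpace 𝓘(ℝ, E₁) ξ.proj)⟩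

/-- The direct image of a tensor `R` of type `(1,2)` by a diffeomorphism `f`: with
`e = d_y (f⁻¹)`, `(f_* R)_y (u, v) = e⁻¹ (R (e u, e v))`, where `R` is taken at `f⁻¹ y`
and `e⁻¹ = df` at `f⁻¹ y`. -/
def pushTensor (f : M₁ ≃ₘ^∞⟮𝓘(ℝ, E₁), 𝓘(ℝ, E₂)⟯ M₂)
    (R : ∀ x : M₁, TangentSpace 𝓘(ℝ, E₁) x →L[ℝ]
      TangentSpace 𝓘(ℝ, E₁) x →L[ℝ] TangentSpace 𝓘(ℝ, E₁) x) (y : M₂) :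
    TangentSpace 𝓘(ℝ, E₂) y →L[ℝ] TangentSpace 𝓘(ℝ, E₂) y →L[ℝ] TangentSpace 𝓘(ℝ, E₂) y :=
  let e : TangentSpace 𝓘(ℝ, E₂) y ≃L[ℝ] TangentSpace 𝓘(ℝ, E₁) (f.symm y) :=
    f.symm.mfderivToContinuousLinearEquiv (by simp) y
  (ContinuousLinearMap.precomp (TangentSpace 𝓘(ℝ, E₂) y)
      (e : TangentSpace 𝓘(ℝ, E₂) y →L[ℝ] TangentSpace 𝓘(ℝ, E₁) (f.symm y))) ∘L
    (ContinuousLinearMap.postcomp (TangentSpace 𝓘(ℝ, E₁) (f.symm y))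
      (e.symm : TangentSpace 𝓘(ℝ, E₁) (f.symm y) →L[ℝ] TangentSpace 𝓘(ℝ, E₂) y)) ∘L
      R (f.symm y) ∘L (e : TangentSpace 𝓘(ℝ, E₂) y →L[ℝ] TangentSpace 𝓘(ℝ, E₁) (f.symm y))

end

end AlmostComplex

end

open AlmostComplex

noncomputable section

namespace AlmostComplex

/-! ### Naturality of the exterior derivative -/

section

variable {E H E' H' : Type*}
  [NormedAddCommGroup E] [NormedSpace ℝ E] [TopologicalSpace H] {I : ModelWithCorners ℝ E H}
  [NormedAddCommGroup E'] [NormedSpace ℝ E'] [TopologicalSpace H'] {I' : ModelWithCorners ℝ E' H'}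
  {N N' : Type*} [TopologicalSpace N] [ChartedSpace H N] [TopologicalSpace N'] [ChartedSpace H' N']

/-! Both lifts have the same shape: by linearity each is the endomorphism `ω_st`-dual to `d(θ(J)) +
θ(R)`, with `R = -½ J N_J` for the complete lift and `R = [∇̃J]` for the horizontal one
(`completeLift_eq`, `horizontalLift_eq`). Everything therefore follows from one equivalence,
`isHolomorphic_cotangentLift_iff`: for smooth fields `A₁`, `A₂` of endomorphisms and arbitrary
tensors `R₁`, `R₂`, the lift `F` of `f` intertwines the two duals iff `df` intertwines `A₁`, `A₂`
and `f_* R₁ = R₂`.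

Such a dual endomorphism lies over `A`, because pairing with vertical vectors sees only the base
component (`dProj_omegaSolve_extDerivOne_add_theta₂`). So applying `dπ` to the holomorphy equation
of `F` gives holomorphy of `f`. Conversely, `F` always preserves the Liouville form and hence
`ω_st`; if `f` is holomorphic it also preserves `θ(A)`, hence `d(θ(A))` by naturality of the
exterior derivative (`extDerivOne_pullback`). After pairing with `ω_st`, what remains of the
holomorphy equation is that `F` carries `θ(R₁)` to `θ(R₂)`. As covectors separate tangent vectors,
this says `f_* R₁ = R₂`.

Part (2) is then immediate. In part (1) the tensor condition is automatic, since a holomorphic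
diffeomorphism carries `N_{J₁}` to `N_{J₂}` (`nijenhuis_mfderiv`). -/

lemma chartForm_pullback [I.Boundaryless] [I'.Boundaryless] [IsManifold I 2 N] [IsManifold I' 2 N']
    {F : N → N'} {p : N} (hF : ContMDiffAt I I' 2 F p)
    (α : ∀ q : N', TangentSpace I' q →L[ℝ] ℝ) :
    chartForm I (fun q ↦ α (F q) ∘L mfderiv I I' F q) p =ᶠ[𝓝 (extChartAt I p p)]
      fun y ↦ (chartForm I' α (F p) (writtenInExtChartAt I I' p F y)) ∘L
        fderiv ℝ (writtenInExtChartAt I I' p F) y := by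
  have : IsManifold I 1 N := .of_le (n := 2) (by norm_num)
  have : IsManifold I' 1 N' := .of_le (n := 2) (by norm_num)
  have h0 : ContinuousAt (extChartAt I p).symm (extChartAt I p p) := continuousAt_extChartAt_symm p
  have hp : (extChartAt I p).symm (extChartAt I p p) = p := extChartAt_to_inv p
  have h1 : ∀ᶠ q in 𝓝 p, ContMDiffAt I I' 2 F q :=
    (contMDiffAt_iff_contMDiffAt_nhds (by simp)).1 hF
  have h2 : ∀ᶠ q in 𝓝 p, F q ∈ (extChartAt I' (F p)).source :=
    hF.continuousAt.eventually (extChartAt_source_mem_nhds (F p))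
  rw [ContinuousAt, hp] at h0
  filter_upwards [h0.eventually h1, h0.eventually h2, extChartAt_target_mem_nhds (I := I) p]
    with y hy1 hy2 hy3
  set φ := extChartAt I p
  set ψ := extChartAt I' (F p)
  set G := writtenInExtChartAt I I' p F with hG
  have dφ : MDifferentiableAt 𝓘(ℝ, E) I φ.symm y := by
    have := mdifferentiableWithinAt_extChartAt_symm (I := I) (x := p) hy3
    rwa [ModelWithCorners.range_eq_univ, mdifferentiableWithinAt_univ] at this
  have dF : MDifferentiableAt I I' F (φ.symm y) := hy1.mdifferentiableAt (by simp)
  have dψ : MDifferentiableAt I' 𝓘(ℝ, E') ψ (F (φ.symm y)) :=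
    mdifferentiableAt_extChartAt (by simpa [ψ] using hy2)
  have dFφ : HasMFDerivAt 𝓘(ℝ, E) I' (F ∘ φ.symm) y
      ((mfderiv I I' F (φ.symm y)) ∘L (mfderiv 𝓘(ℝ, E) I φ.symm y)) :=
    dF.hasMFDerivAt.comp y dφ.hasMFDerivAt
  have dG : MDifferentiableAt 𝓘(ℝ, E) 𝓘(ℝ, E') G y :=
    dψ.comp y dFφ.mdifferentiableAt
  have hGt : G y ∈ ψ.target := ψ.map_source hy2
  have dψs : MDifferentiableAt 𝓘(ℝ, E') I' ψ.symm (G y) := by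
    have := mdifferentiableWithinAt_extChartAt_symm (I := I') (x := F p) hGt
    rwa [ModelWithCorners.range_eq_univ, mdifferentiableWithinAt_univ] at this
  have e1 : HasMFDerivAt 𝓘(ℝ, E) I' (ψ.symm ∘ G) y
      ((mfderiv 𝓘(ℝ, E') I' ψ.symm (G y)) ∘L (mfderiv 𝓘(ℝ, E) 𝓘(ℝ, E') G y)) :=
    dψs.hasMFDerivAt.comp y dG.hasMFDerivAt
  -- The two maps agree only where `F ∘ φ.symm` stays in the source of `ψ`, a neighbourhood of `y`,
  -- which is enough to compare derivatives.
  have e2 : ψ.symm ∘ G =ᶠ[𝓝 y] F ∘ φ.symm := by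
    have : ∀ᶠ z in 𝓝 y, F (φ.symm z) ∈ ψ.source :=
      (dF.continuousAt.comp (f := φ.symm) dφ.continuousAt).eventually
        ((isOpen_extChartAt_source (F p)).mem_nhds hy2)
    filter_upwards [this] with z hz
    exact ψ.left_inv hz
  have e3 := hasMFDerivAt_unique e1 (dFφ.congr_of_eventuallyEq e2)
  have e4 : ψ.symm (G y) = F (φ.symm y) := e2.self_of_nhds
  -- The base points are only propositionally equal, so the two forms are compared in the model
  -- space.
  have e5 : (α (ψ.symm (G y)) : E' →L[ℝ] ℝ) = (α (F (φ.symm y)) : E' →L[ℝ] ℝ) := by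
    rw [e4]
  rw [mfderiv_eq_fderiv] at e3
  ext v
  have e6 := congr($e3 v)
  exact (congr($e5.symm ((mfderiv I I' F (φ.symm y))
    (mfderiv 𝓘(ℝ, E) I φ.symm y v)))).trans congr((α (ψ.symm (G y)) : E' →L[ℝ] ℝ) $e6.symm)

/-- In charts the pulled-back form is `y ↦ β (G y) ∘ DG y`. Its derivative is the expected term plus
`β (D²G (a, b))`, and the latter disappears on antisymmetrizing because second derivatives are
symmetric. -/
lemma extDerivOne_pullback [I.Boundaryless] [I'.Boundaryless] [IsManifold I 2 N]
    [IsManifold I' 2 N'] {F : N → N'} {p : N} (hF : ContMDiffAt I I' 2 F p)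
    (α : ∀ q : N', TangentSpace I' q →L[ℝ] ℝ)
    (hα : DifferentiableAt ℝ (chartForm I' α (F p)) (extChartAt I' (F p) (F p)))
    (u v : TangentSpace I p) :
    extDerivOne I (fun q ↦ α (F q) ∘L mfderiv I I' F q) p u v =
      extDerivOne I' α (F p) (mfderiv I I' F p u) (mfderiv I I' F p v) := by
  have : IsManifold I 1 N := .of_le (n := 2) (by norm_num)
  have : IsManifold I' 1 N' := .of_le (n := 2) (by norm_num)
  set G := writtenInExtChartAt I I' p F with hG
  set y := extChartAt I p p with hy
  have hGs : ContDiffAt ℝ 2 G y := by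
    have := (contMDiffAt_iff.1 hF).2
    rwa [ModelWithCorners.range_eq_univ, contDiffWithinAt_univ] at this
  have hGy : G y = extChartAt I' (F p) (F p) := by
    simp only [hG, hy, writtenInExtChartAt, Function.comp_apply, extChartAt_to_inv]
  have hd : ∀ w : TangentSpace I p,
      fderiv ℝ G y (dChart I p w) = dChart I' (F p) (mfderiv I I' F p w) := by
    intro w
    have dF : MDifferentiableAt I I' F p := hF.mdifferentiableAt (by simp)
    have e1 : HasMFDerivAt I 𝓘(ℝ, E') (extChartAt I' (F p) ∘ F) p
        (dChart I' (F p) ∘L mfderiv I I' F p) :=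
      (mdifferentiableAt_extChartAt (mem_chart_source H' (F p))).hasMFDerivAt.comp p
        dF.hasMFDerivAt
    have dG : HasMFDerivAt 𝓘(ℝ, E) 𝓘(ℝ, E') G (extChartAt I p p) (fderiv ℝ G y) :=
      (hGs.differentiableAt (by norm_num)).hasFDerivAt.hasMFDerivAt
    have e2 : HasMFDerivAt I 𝓘(ℝ, E') (G ∘ extChartAt I p) p (fderiv ℝ G y ∘L dChart I p) :=
      dG.comp p (mdifferentiableAt_extChartAt (mem_chart_source H p)).hasMFDerivAt
    have e3 : extChartAt I' (F p) ∘ F =ᶠ[𝓝 p] G ∘ extChartAt I p := by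
      filter_upwards [extChartAt_source_mem_nhds (I := I) p] with q hq
      simp only [hG, writtenInExtChartAt, Function.comp_apply, (extChartAt I p).left_inv hq]
    exact congr($(hasMFDerivAt_unique e2 (e1.congr_of_eventuallyEq e3.symm)) w)
  have hβ : HasFDerivAt (chartForm I' α (F p)) (fderiv ℝ (chartForm I' α (F p)) (G y)) (G y) := by
    rw [hGy]; exact hα.hasFDerivAt
  have hD : HasFDerivAt (fderiv ℝ G) (fderiv ℝ (fderiv ℝ G) y) y :=
    ((hGs.fderiv_right (m := 1) (by norm_num)).differentiableAt (by norm_num)).hasFDerivAt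
  have hc := (hβ.comp y (hGs.differentiableAt (by norm_num)).hasFDerivAt).clm_comp hD
  have hsym : IsSymmSndFDerivAt ℝ G y := hGs.isSymmSndFDerivAt (by simp)
  have key : ∀ a b : E, fderiv ℝ (chartForm I (fun q ↦ α (F q) ∘L mfderiv I I' F q) p) y a b =
      chartForm I' α (F p) (G y) (fderiv ℝ (fderiv ℝ G) y a b) +
        fderiv ℝ (chartForm I' α (F p)) (G y) (fderiv ℝ G y a) (fderiv ℝ G y b) := by
    intro a b
    rw [(hc.congr_of_eventuallyEq (chartForm_pullback hF α)).fderiv]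
    simp
  rw [extDerivOne_apply, extDerivOne_apply, key, key, hsym.eq, hd, hd, hGy]
  ring

end

/-! ### Smoothness of the lift of a diffeomorphism -/

section

variable {E₁ E₂ : Type*} [NormedAddCommGroup E₁] [NormedSpace ℝ E₁]
  [NormedAddCommGroup E₂] [NormedSpace ℝ E₂]
  {M₁ M₂ : Type*} [TopologicalSpace M₁] [ChartedSpace E₁ M₁]
  [TopologicalSpace M₂] [ChartedSpace E₂ M₂]

lemma mfderiv_symm_mfderiv (f : M₁ ≃ₘ^∞⟮𝓘(ℝ, E₁), 𝓘(ℝ, E₂)⟯ M₂) (x : M₁)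
    (u : TangentSpace 𝓘(ℝ, E₁) x) :
    mfderiv 𝓘(ℝ, E₂) 𝓘(ℝ, E₁) f.symm (f x) (mfderiv 𝓘(ℝ, E₁) 𝓘(ℝ, E₂) f x u) = u := by
  have h := (f.symm.mdifferentiable (by simp) (f x)).hasMFDerivAt.comp x
    (f.mdifferentiable (by simp) x).hasMFDerivAt
  have e : f.symm ∘ f = id := by ext; simp
  rw [e] at h
  exact congr($(hasMFDerivAt_unique h (hasMFDerivAt_id x)) u)

/-- Trades the inverse of `df` for the derivative of `f⁻¹`, whose smooth dependence on the base
point is known. -/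
lemma cotangentLift_snd (f : M₁ ≃ₘ^∞⟮𝓘(ℝ, E₁), 𝓘(ℝ, E₂)⟯ M₂) (ξ : CotangentBundle E₁ M₁)
    (v : TangentSpace 𝓘(ℝ, E₂) (f ξ.proj)) :
    covector (cotangentLift f ξ) v =
      (covector ξ : E₁ →L[ℝ] ℝ) (mfderiv 𝓘(ℝ, E₂) 𝓘(ℝ, E₁) f.symm (f ξ.proj) v) := by
  obtain ⟨u, rfl⟩ := (f.mfderivToContinuousLinearEquiv (by simp) ξ.proj).surjective v
  have h1 : mfderiv 𝓘(ℝ, E₂) 𝓘(ℝ, E₁) f.symm (f ξ.proj)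
      (f.mfderivToContinuousLinearEquiv (by simp) ξ.proj u) = u := mfderiv_symm_mfderiv f ξ.proj u
  have h2 : covector (cotangentLift f ξ) (f.mfderivToContinuousLinearEquiv (by simp) ξ.proj u) =
      covector ξ u := congr(covector ξ
        $((f.mfderivToContinuousLinearEquiv (by simp) ξ.proj).symm_apply_apply u))
  exact h2.trans congr((covector ξ : E₁ →L[ℝ] ℝ) $h1.symm)

variable [IsManifold 𝓘(ℝ, E₁) ∞ M₁] [IsManifold 𝓘(ℝ, E₂) ∞ M₂]

/-- In trivializations the fibre part is the coordinate expression of the covector composed with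
that of `d(f⁻¹)` at `f (π η)`, and both factors depend smoothly on `η`. -/
lemma contMDiff_cotangentLift (f : M₁ ≃ₘ^∞⟮𝓘(ℝ, E₁), 𝓘(ℝ, E₂)⟯ M₂) :
    ContMDiff (cotangentModel E₁) (cotangentModel E₂) ∞ (cotangentLift f) := by
  intro ξ₀
  have hproj : ContMDiffAt (cotangentModel E₁) 𝓘(ℝ, E₁) ∞
      (fun η : CotangentBundle E₁ M₁ ↦ η.proj) ξ₀ := Bundle.contMDiffAt_proj _
  -- Smoothness of the identity of `T^* M₁`, read in the bundle of homomorphisms, says that the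
  -- fibre coordinate of a covector is smooth.
  have hid := ((contMDiffAt_hom_bundle (n := ∞) (IM := cotangentModel E₁) (IB := 𝓘(ℝ, E₁))
    (fun η : CotangentBundle E₁ M₁ ↦ η) (x₀ := ξ₀)).1 contMDiffAt_id).2
  have hfs := (f.symm.contMDiff.contMDiffAt (x := f ξ₀.proj)).mfderiv_const (m := ∞) (by simp)
  have hfp : ContMDiffAt (cotangentModel E₁) 𝓘(ℝ, E₂) ∞
      (fun η : CotangentBundle E₁ M₁ ↦ f η.proj) ξ₀ := f.contMDiff.contMDiffAt.comp ξ₀ hproj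
  have hc := hid.clm_comp (hfs.comp ξ₀ hfp)
  refine (contMDiffAt_hom_bundle _).2 ⟨hfp, hc.congr_of_eventuallyEq ?_⟩
  have hb : ∀ᶠ η in 𝓝 ξ₀, η.proj ∈ (trivializationAt E₁ (TangentSpace 𝓘(ℝ, E₁)) ξ₀.proj).baseSet :=
    hproj.continuousAt.eventually ((trivializationAt E₁ (TangentSpace 𝓘(ℝ, E₁))
      ξ₀.proj).open_baseSet.mem_nhds (FiberBundle.mem_baseSet_trivializationAt' ξ₀.proj))
  filter_upwards [hb] with η hη
  -- Stated for a general `x` because `f.symm (f η.proj)` and `η.proj` are only propositionally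
  -- equal.
  have aux : ∀ (x : M₁) (_ : η.proj = x) (w : TangentSpace 𝓘(ℝ, E₁) x),
      Trivialization.symmL ℝ (trivializationAt E₁ (TangentSpace 𝓘(ℝ, E₁)) ξ₀.proj) η.proj
        (Trivialization.continuousLinearMapAt ℝ
          (trivializationAt E₁ (TangentSpace 𝓘(ℝ, E₁)) ξ₀.proj) x w) = (show E₁ from w) := by
    rintro x rfl w
    exact Trivialization.symmL_continuousLinearMapAt _ hη w
  ext v
  simp only [ContinuousLinearMap.inCoordinates, Trivial.fiberBundle_trivializationAt',
    Trivial.continuousLinearMapAt_trivialization, ContinuousLinearMap.id_comp,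
    ContinuousLinearMap.comp_apply, Function.comp_apply, inTangentCoordinates,
    Diffeomorph.symm_apply_apply, id_eq, Trivialization.continuousLinearMapAt_apply]
  exact (cotangentLift_snd f η _).trans
    congr((covector η : E₁ →L[ℝ] ℝ) $((aux _ (f.symm_apply_apply η.proj).symm _).symm))

end

/-! ### The form `θ(A)` in canonical coordinates -/

section

variable {E : Type*} [NormedAddCommGroup E] [NormedSpace ℝ E]
  {M : Type*} [TopologicalSpace M] [ChartedSpace E M] [IsManifold 𝓘(ℝ, E) ∞ M]

/-- The field `A` of endomorphisms in the chart at `x₀`. -/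
def chartField (A : ∀ x : M, TangentSpace 𝓘(ℝ, E) x →L[ℝ] TangentSpace 𝓘(ℝ, E) x) (x₀ : M)
    (z : E) : E →L[ℝ] E :=
  ContinuousLinearMap.inCoordinates E (TangentSpace 𝓘(ℝ, E)) E (TangentSpace 𝓘(ℝ, E))
    x₀ ((extChartAt 𝓘(ℝ, E) x₀).symm z) x₀ ((extChartAt 𝓘(ℝ, E) x₀).symm z)
    (A ((extChartAt 𝓘(ℝ, E) x₀).symm z))

lemma differentiableAt_chartField
    {A : ∀ x : M, TangentSpace 𝓘(ℝ, E) x →L[ℝ] TangentSpace 𝓘(ℝ, E) x} {x₀ : M}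
    (hA : ContMDiffAt 𝓘(ℝ, E) (𝓘(ℝ, E).prod 𝓘(ℝ, E →L[ℝ] E)) ∞
      (fun x : M ↦ TotalSpace.mk' (E →L[ℝ] E)
        (E := fun x : M ↦ TangentSpace 𝓘(ℝ, E) x →L[ℝ] TangentSpace 𝓘(ℝ, E) x) x (A x)) x₀) :
    DifferentiableAt ℝ (chartField A x₀) (extChartAt 𝓘(ℝ, E) x₀ x₀) := by
  have h1 : MDifferentiableAt 𝓘(ℝ, E) 𝓘(ℝ, E →L[ℝ] E) (fun x : M ↦
      ContinuousLinearMap.inCoordinates E (TangentSpace 𝓘(ℝ, E)) E (TangentSpace 𝓘(ℝ, E))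
        x₀ x x₀ x (A x)) ((extChartAt 𝓘(ℝ, E) x₀).symm (extChartAt 𝓘(ℝ, E) x₀ x₀)) := by
    rw [extChartAt_to_inv]
    exact ((contMDiffAt_hom_bundle _).1 hA).2.mdifferentiableAt (by simp)
  have h2 : MDifferentiableAt 𝓘(ℝ, E) 𝓘(ℝ, E) (extChartAt 𝓘(ℝ, E) x₀).symm
      (extChartAt 𝓘(ℝ, E) x₀ x₀) := by
    have := mdifferentiableWithinAt_extChartAt_symm (I := 𝓘(ℝ, E)) (x := x₀)
      (mem_extChartAt_target x₀)
    rwa [ModelWithCorners.range_eq_univ, mdifferentiableWithinAt_univ] at this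
  exact (MDifferentiableAt.comp (extChartAt 𝓘(ℝ, E) x₀ x₀) h1 h2).differentiableAt

lemma extChartAt_cotangent_symm_proj (ξ : CotangentBundle E M) {y : E × (E →L[ℝ] ℝ)}
    (hy : y ∈ (extChartAt (cotangentModel E) ξ).target) :
    ((extChartAt (cotangentModel E) ξ).symm y).proj = (extChartAt 𝓘(ℝ, E) ξ.proj).symm y.1 ∧
      ((extChartAt (cotangentModel E) ξ).symm y).proj ∈ (chartAt E ξ.proj).source := by
  have h1 := (extChartAt (cotangentModel E) ξ).map_target hy
  have h2 : ((extChartAt (cotangentModel E) ξ).symm y).proj ∈ (chartAt E ξ.proj).source := by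
    rw [extChartAt_source, FiberBundle.chartedSpace_chartAt] at h1
    simp only [mfld_simps] at h1
    exact h1.1.1
  refine ⟨?_, h2⟩
  have h3 := extChartAt_cotangent_fst ξ ((extChartAt (cotangentModel E) ξ).symm y)
  rw [(extChartAt (cotangentModel E) ξ).right_inv hy] at h3
  rw [h3, (extChartAt 𝓘(ℝ, E) ξ.proj).left_inv (by simpa using h2)]

/-- In canonical coordinates `π` is `(x, p) ↦ x`, and the derivative of the inverse base chart is
the inverse of the tangent trivialization. -/
lemma dProj_mfderiv_extChartAt_symm (ξ : CotangentBundle E M) {y : E × (E →L[ℝ] ℝ)}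
    (hy : y ∈ (extChartAt (cotangentModel E) ξ).target) (v : E × (E →L[ℝ] ℝ)) :
    dProj ((extChartAt (cotangentModel E) ξ).symm y)
        (mfderiv 𝓘(ℝ, E × (E →L[ℝ] ℝ)) (cotangentModel E)
          (extChartAt (cotangentModel E) ξ).symm y v) =
      Trivialization.symmL ℝ (trivializationAt E (TangentSpace 𝓘(ℝ, E)) ξ.proj)
        ((extChartAt (cotangentModel E) ξ).symm y).proj v.1 := by
  set φ := extChartAt (cotangentModel E) ξ with hφ
  have hto : IsOpen φ.target := isOpen_extChartAt_target ξ
  have hd : MDifferentiableAt 𝓘(ℝ, E × (E →L[ℝ] ℝ)) (cotangentModel E) φ.symm y := by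
    have := mdifferentiableWithinAt_extChartAt_symm (I := cotangentModel E) (x := ξ) hy
    rwa [ModelWithCorners.range_eq_univ, mdifferentiableWithinAt_univ] at this
  have hy0 : extChartAt 𝓘(ℝ, E) ξ.proj (φ.symm y).proj = y.1 := by
    rw [← extChartAt_cotangent_fst, ← hφ, φ.right_inv hy]
  have hy1 : y.1 ∈ (extChartAt 𝓘(ℝ, E) ξ.proj).target := by
    rw [← hy0]
    exact (extChartAt 𝓘(ℝ, E) ξ.proj).map_source
      (by rw [extChartAt_source]; exact (extChartAt_cotangent_symm_proj ξ hy).2)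
  have hd1 : MDifferentiableAt 𝓘(ℝ, E) 𝓘(ℝ, E) (extChartAt 𝓘(ℝ, E) ξ.proj).symm y.1 := by
    have := mdifferentiableWithinAt_extChartAt_symm (I := 𝓘(ℝ, E)) (x := ξ.proj) hy1
    rwa [ModelWithCorners.range_eq_univ, mdifferentiableWithinAt_univ] at this
  have hfst : HasMFDerivAt 𝓘(ℝ, E × (E →L[ℝ] ℝ)) 𝓘(ℝ, E) (Prod.fst : E × (E →L[ℝ] ℝ) → E) y
      (ContinuousLinearMap.fst ℝ E (E →L[ℝ] ℝ)) := hasFDerivAt_fst.hasMFDerivAt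
  have e1 : HasMFDerivAt 𝓘(ℝ, E × (E →L[ℝ] ℝ)) 𝓘(ℝ, E)
      ((fun η : CotangentBundle E M ↦ η.proj) ∘ φ.symm) y
      (dProj (φ.symm y) ∘L mfderiv 𝓘(ℝ, E × (E →L[ℝ] ℝ)) (cotangentModel E) φ.symm y) :=
    (mdifferentiable_proj _).hasMFDerivAt.comp y hd.hasMFDerivAt
  have e2 : HasMFDerivAt 𝓘(ℝ, E × (E →L[ℝ] ℝ)) 𝓘(ℝ, E)
      ((extChartAt 𝓘(ℝ, E) ξ.proj).symm ∘ Prod.fst) y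
      (mfderiv 𝓘(ℝ, E) 𝓘(ℝ, E) (extChartAt 𝓘(ℝ, E) ξ.proj).symm y.1 ∘L
        ContinuousLinearMap.fst ℝ E (E →L[ℝ] ℝ)) :=
    hd1.hasMFDerivAt.comp y hfst
  have e3 := hasMFDerivAt_unique e1 (e2.congr_of_eventuallyEq
    (Filter.eventuallyEq_of_mem (hto.mem_nhds hy) fun z hz ↦
      (extChartAt_cotangent_symm_proj ξ hz).1))
  rw [TangentBundle.symmL_trivializationAt (extChartAt_cotangent_symm_proj ξ hy).2,
    ModelWithCorners.range_eq_univ, mfderivWithin_univ]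
  rw [← hy0] at e3
  exact congr($e3 v)

/-- This is the local formula `p_k A^k_l(x) dx^l`. The fibre coordinate is the covector composed
with the inverse tangent trivialization, which cancels the trivialization on the output side of
`chartField`. -/
lemma chartForm_theta₁ (A : ∀ x : M, TangentSpace 𝓘(ℝ, E) x →L[ℝ] TangentSpace 𝓘(ℝ, E) x)
    (ξ : CotangentBundle E M) {y : E × (E →L[ℝ] ℝ)}
    (hy : y ∈ (extChartAt (cotangentModel E) ξ).target) :
    chartForm (cotangentModel E) (theta₁ A) ξ y =
      y.2 ∘L chartField A ξ.proj y.1 ∘L ContinuousLinearMap.fst ℝ E (E →L[ℝ] ℝ) := by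
  obtain ⟨h1, h2⟩ := extChartAt_cotangent_symm_proj ξ hy
  have h3 := extChartAt_cotangent_snd ξ ((extChartAt (cotangentModel E) ξ).symm y) h2
  rw [(extChartAt (cotangentModel E) ξ).right_inv hy, ← mfderivWithin_univ,
    ← ModelWithCorners.range_eq_univ 𝓘(ℝ, E), ← TangentBundle.symmL_trivializationAt h2] at h3
  rw [chartField, ← h1, h3]
  refine ContinuousLinearMap.ext fun v ↦ ?_
  have h4 := dProj_mfderiv_extChartAt_symm ξ hy v
  have h5 : ∀ w, Trivialization.symmL ℝ (trivializationAt E (TangentSpace 𝓘(ℝ, E)) ξ.proj)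
      ((extChartAt (cotangentModel E) ξ).symm y).proj
      (Trivialization.continuousLinearMapAt ℝ (trivializationAt E (TangentSpace 𝓘(ℝ, E)) ξ.proj)
        ((extChartAt (cotangentModel E) ξ).symm y).proj w) = w :=
    fun w ↦ Trivialization.symmL_continuousLinearMapAt _
      (by simpa [TangentBundle.trivializationAt_baseSet] using h2) w
  refine (congr(covector ((extChartAt (cotangentModel E) ξ).symm y)
    (A ((extChartAt (cotangentModel E) ξ).symm y).proj $h4))).trans ?_
  exact congr(covector ((extChartAt (cotangentModel E) ξ).symm y) $((h5 _).symm))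

/-- The Leibniz rule for the form `p ∘ B(x)` on the model space. A constant `B = Id` covers the
Liouville form. -/
lemma hasFDerivAt_snd_comp_field_comp_fst {F : Type*} [NormedAddCommGroup F] [NormedSpace ℝ F]
    {B : F → F →L[ℝ] F} {p : F × (F →L[ℝ] ℝ)} (hB : DifferentiableAt ℝ B p.1)
    {β : F × (F →L[ℝ] ℝ) → F × (F →L[ℝ] ℝ) →L[ℝ] ℝ}
    (hβ : ∀ᶠ y in 𝓝 p, β y = y.2 ∘L B y.1 ∘L ContinuousLinearMap.fst ℝ F (F →L[ℝ] ℝ)) :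
    DifferentiableAt ℝ β p ∧ ∀ u v : F × (F →L[ℝ] ℝ),
      fderiv ℝ β p u v = u.2 (B p.1 v.1) + p.2 (fderiv ℝ B p.1 u.1 v.1) := by
  have h1 := (hB.hasFDerivAt.comp p hasFDerivAt_fst).clm_comp
    (hasFDerivAt_const (ContinuousLinearMap.fst ℝ F (F →L[ℝ] ℝ)) p)
  have h2 := (hasFDerivAt_snd.clm_comp h1).congr_of_eventuallyEq hβ
  refine ⟨h2.differentiableAt, fun u v ↦ ?_⟩
  rw [h2.fderiv]
  simp [add_comm]

/-- Differentiability allows `d(θ(A))` to be pulled back; the explicit derivative serves to find the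
base component of the dual endomorphism. -/
lemma differentiableAt_chartForm_theta₁
    {A : ∀ x : M, TangentSpace 𝓘(ℝ, E) x →L[ℝ] TangentSpace 𝓘(ℝ, E) x} {ξ : CotangentBundle E M}
    (hA : ContMDiffAt 𝓘(ℝ, E) (𝓘(ℝ, E).prod 𝓘(ℝ, E →L[ℝ] E)) ∞
      (fun x : M ↦ TotalSpace.mk' (E →L[ℝ] E)
        (E := fun x : M ↦ TangentSpace 𝓘(ℝ, E) x →L[ℝ] TangentSpace 𝓘(ℝ, E) x) x (A x)) ξ.proj) :
    DifferentiableAt ℝ (chartForm (cotangentModel E) (theta₁ A) ξ)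
        (extChartAt (cotangentModel E) ξ ξ) ∧
      ∀ u v : E × (E →L[ℝ] ℝ), fderiv ℝ (chartForm (cotangentModel E) (theta₁ A) ξ)
        (extChartAt (cotangentModel E) ξ ξ) u v =
          u.2 (chartField A ξ.proj (extChartAt 𝓘(ℝ, E) ξ.proj ξ.proj) v.1) +
            (extChartAt (cotangentModel E) ξ ξ).2
              (fderiv ℝ (chartField A ξ.proj) (extChartAt 𝓘(ℝ, E) ξ.proj ξ.proj) u.1 v.1) := by
  rw [← extChartAt_cotangent_fst ξ ξ]
  refine hasFDerivAt_snd_comp_field_comp_fst ?_ (Filter.eventually_of_mem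
    (extChartAt_target_mem_nhds ξ) fun y hy ↦ chartForm_theta₁ A ξ hy)
  rw [extChartAt_cotangent_fst ξ ξ]
  exact differentiableAt_chartField hA

lemma dChart_cotangent_fst (ξ : CotangentBundle E M) (V : TangentSpace (cotangentModel E) ξ) :
    (dChart (cotangentModel E) ξ V).1 = dChart 𝓘(ℝ, E) ξ.proj (dProj ξ V) := by
  have h1 : HasMFDerivAt (cotangentModel E) 𝓘(ℝ, E × (E →L[ℝ] ℝ))
      (extChartAt (cotangentModel E) ξ) ξ (dChart (cotangentModel E) ξ) :=
    (mdifferentiableAt_extChartAt (mem_chart_source _ ξ)).hasMFDerivAt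
  have hfst : HasMFDerivAt 𝓘(ℝ, E × (E →L[ℝ] ℝ)) 𝓘(ℝ, E) (Prod.fst : E × (E →L[ℝ] ℝ) → E)
      (extChartAt (cotangentModel E) ξ ξ) (ContinuousLinearMap.fst ℝ E (E →L[ℝ] ℝ)) :=
    hasFDerivAt_fst.hasMFDerivAt
  have h2 : HasMFDerivAt 𝓘(ℝ, E) 𝓘(ℝ, E) (extChartAt 𝓘(ℝ, E) ξ.proj) ξ.proj
      (dChart 𝓘(ℝ, E) ξ.proj) :=
    (mdifferentiableAt_extChartAt (mem_chart_source E ξ.proj)).hasMFDerivAt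
  have h3 : HasMFDerivAt (cotangentModel E) 𝓘(ℝ, E)
      (extChartAt 𝓘(ℝ, E) ξ.proj ∘ fun η : CotangentBundle E M ↦ η.proj) ξ
      (dChart 𝓘(ℝ, E) ξ.proj ∘L dProj ξ) := h2.comp ξ (mdifferentiable_proj ξ).hasMFDerivAt
  have h4 := hfst.comp ξ h1
  have e : Prod.fst ∘ extChartAt (cotangentModel E) ξ =
      extChartAt 𝓘(ℝ, E) ξ.proj ∘ fun η : CotangentBundle E M ↦ η.proj :=
    funext (extChartAt_cotangent_fst ξ)
  rw [e] at h4
  exact congr($(hasMFDerivAt_unique h4 h3) V)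

lemma dChart_isInvertible {E H : Type*} [NormedAddCommGroup E] [NormedSpace ℝ E]
    [TopologicalSpace H] (I : ModelWithCorners ℝ E H) {N : Type*} [TopologicalSpace N]
    [ChartedSpace H N] [IsManifold I 1 N] (p : N) : (dChart I p).IsInvertible :=
  isInvertible_mfderiv_extChartAt (mem_extChartAt_source (I := I) p)

lemma dProj_surjective (ξ : CotangentBundle E M) : Function.Surjective (dProj ξ) := by
  intro v
  have : IsManifold 𝓘(ℝ, E) 1 M := .of_le (n := ∞) (by simp)
  have : IsManifold (cotangentModel E) 1 (CotangentBundle E M) := .of_le (n := ∞) (by simp)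
  obtain ⟨e, he⟩ := dChart_isInvertible (cotangentModel E) ξ
  obtain ⟨e', he'⟩ := dChart_isInvertible 𝓘(ℝ, E) ξ.proj
  refine ⟨e.symm (e' v, 0), e'.injective ?_⟩
  have h := dChart_cotangent_fst ξ (e.symm (e' v, 0))
  rw [← he, ← he'] at h
  exact h.symm.trans congr(($(e.apply_symm_apply (e' v, 0))).1)

lemma chartField_dChart (A : ∀ x : M, TangentSpace 𝓘(ℝ, E) x →L[ℝ] TangentSpace 𝓘(ℝ, E) x)
    (x : M) (v : TangentSpace 𝓘(ℝ, E) x) :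
    chartField A x (extChartAt 𝓘(ℝ, E) x x) (dChart 𝓘(ℝ, E) x v) =
      dChart 𝓘(ℝ, E) x (A x v) := by
  have h1 : dChart 𝓘(ℝ, E) x =
      Trivialization.continuousLinearMapAt ℝ (trivializationAt E (TangentSpace 𝓘(ℝ, E)) x) x :=
    (TangentBundle.continuousLinearMapAt_trivializationAt (mem_chart_source E x)).symm
  have h2 := Trivialization.symmL_continuousLinearMapAt (R := ℝ)
    (trivializationAt E (TangentSpace 𝓘(ℝ, E)) x) (FiberBundle.mem_baseSet_trivializationAt' x) v
  rw [chartField, extChartAt_to_inv, h1]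
  exact congr(Trivialization.continuousLinearMapAt ℝ
    (trivializationAt E (TangentSpace 𝓘(ℝ, E)) x) x (A x $h2))

/-- An endomorphism dual to `d(θ(A)) + θ(R)` lies over `A`. -/
lemma dProj_omegaSolve_extDerivOne_add_theta₂ [FiniteDimensional ℝ E]
    {A : ∀ x : M, TangentSpace 𝓘(ℝ, E) x →L[ℝ] TangentSpace 𝓘(ℝ, E) x} {ξ : CotangentBundle E M}
    (hA : ContMDiffAt 𝓘(ℝ, E) (𝓘(ℝ, E).prod 𝓘(ℝ, E →L[ℝ] E)) ∞
      (fun x : M ↦ TotalSpace.mk' (E →L[ℝ] E)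
        (E := fun x : M ↦ TangentSpace 𝓘(ℝ, E) x →L[ℝ] TangentSpace 𝓘(ℝ, E) x) x (A x)) ξ.proj)
    (R : ∀ x : M, TangentSpace 𝓘(ℝ, E) x →L[ℝ]
      TangentSpace 𝓘(ℝ, E) x →L[ℝ] TangentSpace 𝓘(ℝ, E) x)
    (V : TangentSpace (cotangentModel E) ξ) :
    dProj ξ (omegaSolve ξ (extDerivOne (cotangentModel E) (theta₁ A) ξ + theta₂ R ξ) V) =
      A ξ.proj (dProj ξ V) := by
  have : IsManifold 𝓘(ℝ, E) 1 M := .of_le (n := ∞) (by simp)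
  have : IsManifold (cotangentModel E) 1 (CotangentBundle E M) := .of_le (n := ∞) (by simp)
  obtain ⟨e, he⟩ := dChart_isInvertible (cotangentModel E) ξ
  obtain ⟨e', he'⟩ := dChart_isInvertible 𝓘(ℝ, E) ξ.proj
  apply e'.injective
  rw [← ContinuousLinearEquiv.coe_coe]
  rw [he', ← chartField_dChart, ← dChart_cotangent_fst, ← dChart_cotangent_fst]
  refine sub_eq_zero.1 (SeparatingDual.eq_zero_of_forall_dual_eq_zero (R := ℝ) fun g ↦ ?_)
  -- A vertical test vector with fibre coordinate `g`. Against `W`, the form `ω_st` returns `-g` of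
  -- the base component, `d(θ(A))` returns `-g` of `A` applied to the base component, and `θ(R)`
  -- vanishes.
  set W : TangentSpace (cotangentModel E) ξ := e.symm (0, g) with hW
  have hW1 : dChart (cotangentModel E) ξ W = (0, g) := by
    rw [← he]; exact e.apply_symm_apply (0, g)
  have hW2 : dProj ξ W = 0 := by
    apply e'.injective
    have := dChart_cotangent_fst ξ W
    rw [hW1, ← he'] at this
    exact this.symm.trans (map_zero e').symm
  have h1 := omegaSt_omegaSolve ξ
    (extDerivOne (cotangentModel E) (theta₁ A) ξ + theta₂ R ξ) V W
  have h2 := (differentiableAt_chartForm_theta₁ hA).2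
  rw [omegaSt_apply, add_apply, add_apply,
    theta₂_apply, extDerivOne_apply, h2, h2, hW1, hW2] at h1
  simp only [map_zero, zero_sub, add_zero, zero_apply] at h1
  rw [map_sub]
  linarith

end

/-! ### Naturality of the lifts -/

section

variable {E₁ E₂ : Type*} [NormedAddCommGroup E₁] [NormedSpace ℝ E₁]
  [NormedAddCommGroup E₂] [NormedSpace ℝ E₂]
  {M₁ M₂ : Type*} [TopologicalSpace M₁] [ChartedSpace E₁ M₁]
  [TopologicalSpace M₂] [ChartedSpace E₂ M₂]

lemma two_le_infty : (2 : ℕ∞ω) ≤ ∞ := WithTop.coe_le_coe.2 le_top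

lemma mfderiv_mfderiv_symm (f : M₁ ≃ₘ^∞⟮𝓘(ℝ, E₁), 𝓘(ℝ, E₂)⟯ M₂) (y : M₂)
    (u : TangentSpace 𝓘(ℝ, E₂) y) :
    (show E₂ from mfderiv 𝓘(ℝ, E₁) 𝓘(ℝ, E₂) f (f.symm y)
      (mfderiv 𝓘(ℝ, E₂) 𝓘(ℝ, E₁) f.symm y u)) = u :=
  mfderiv_symm_mfderiv f.symm y u

lemma covector_cotangentLift_mfderiv (f : M₁ ≃ₘ^∞⟮𝓘(ℝ, E₁), 𝓘(ℝ, E₂)⟯ M₂)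
    (ξ : CotangentBundle E₁ M₁) (u : TangentSpace 𝓘(ℝ, E₁) ξ.proj) :
    covector (cotangentLift f ξ) (mfderiv 𝓘(ℝ, E₁) 𝓘(ℝ, E₂) f ξ.proj u) = covector ξ u :=
  (cotangentLift_snd f ξ _).trans congr((covector ξ : E₁ →L[ℝ] ℝ) $(mfderiv_symm_mfderiv f ξ.proj u))

lemma pushTensor_apply (f : M₁ ≃ₘ^∞⟮𝓘(ℝ, E₁), 𝓘(ℝ, E₂)⟯ M₂)
    (R : ∀ x : M₁, TangentSpace 𝓘(ℝ, E₁) x →L[ℝ]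
      TangentSpace 𝓘(ℝ, E₁) x →L[ℝ] TangentSpace 𝓘(ℝ, E₁) x) (y : M₂)
    (u v : TangentSpace 𝓘(ℝ, E₂) y) :
    pushTensor f R y u v = (show E₂ from mfderiv 𝓘(ℝ, E₁) 𝓘(ℝ, E₂) f (f.symm y)
      (R (f.symm y) (mfderiv 𝓘(ℝ, E₂) 𝓘(ℝ, E₁) f.symm y u)
        (mfderiv 𝓘(ℝ, E₂) 𝓘(ℝ, E₁) f.symm y v))) := by
  have aux : ∀ w : TangentSpace 𝓘(ℝ, E₁) (f.symm y),
      (f.symm.mfderivToContinuousLinearEquiv (by simp) y).symm w =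
        (show E₂ from mfderiv 𝓘(ℝ, E₁) 𝓘(ℝ, E₂) f (f.symm y) w) := by
    intro w
    obtain ⟨a, rfl⟩ := (f.symm.mfderivToContinuousLinearEquiv (by simp) y).surjective w
    rw [ContinuousLinearEquiv.symm_apply_apply]
    exact (mfderiv_mfderiv_symm f y a).symm
  exact aux _

/-- Evaluating on vectors of the form `df u` removes `f⁻¹` and gives the form of the condition that
can be paired with lifted covectors. -/
lemma pushTensor_eq_iff (f : M₁ ≃ₘ^∞⟮𝓘(ℝ, E₁), 𝓘(ℝ, E₂)⟯ M₂)
    (R₁ : ∀ x : M₁, TangentSpace 𝓘(ℝ, E₁) x →L[ℝ]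
      TangentSpace 𝓘(ℝ, E₁) x →L[ℝ] TangentSpace 𝓘(ℝ, E₁) x)
    (R₂ : ∀ y : M₂, TangentSpace 𝓘(ℝ, E₂) y →L[ℝ]
      TangentSpace 𝓘(ℝ, E₂) y →L[ℝ] TangentSpace 𝓘(ℝ, E₂) y) :
    (∀ y, pushTensor f R₁ y = R₂ y) ↔ ∀ (x : M₁) (u v : TangentSpace 𝓘(ℝ, E₁) x),
      R₂ (f x) (mfderiv 𝓘(ℝ, E₁) 𝓘(ℝ, E₂) f x u) (mfderiv 𝓘(ℝ, E₁) 𝓘(ℝ, E₂) f x v) =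
        mfderiv 𝓘(ℝ, E₁) 𝓘(ℝ, E₂) f x (R₁ x u v) := by
  constructor
  · intro h x u v
    have aux : ∀ (z : M₁) (_ : z = x) (a b : E₁),
        (show E₂ from mfderiv 𝓘(ℝ, E₁) 𝓘(ℝ, E₂) f z (R₁ z a b)) =
          (show E₂ from mfderiv 𝓘(ℝ, E₁) 𝓘(ℝ, E₂) f x (R₁ x a b)) := by
      rintro z rfl a b; rfl
    rw [← h (f x), pushTensor_apply]
    refine (aux _ (f.symm_apply_apply x) _ _).trans ?_
    exact congr(mfderiv 𝓘(ℝ, E₁) 𝓘(ℝ, E₂) f x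
      (R₁ x $(mfderiv_symm_mfderiv f x u) $(mfderiv_symm_mfderiv f x v)))
  · intro h y
    have aux : ∀ (z : M₂) (_ : z = y) (a b : E₂),
        (show E₂ from R₂ z a b) = (show E₂ from R₂ y a b) := by
      rintro z rfl a b; rfl
    refine ContinuousLinearMap.ext fun u ↦ ContinuousLinearMap.ext fun v ↦ ?_
    rw [pushTensor_apply, ← h]
    refine (aux _ (f.apply_symm_apply y) _ _).trans ?_
    exact congr((R₂ y : E₂ →L[ℝ] E₂ →L[ℝ] E₂) $(mfderiv_mfderiv_symm f y u)
      $(mfderiv_mfderiv_symm f y v))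

variable [IsManifold 𝓘(ℝ, E₁) ∞ M₁] [IsManifold 𝓘(ℝ, E₂) ∞ M₂]

lemma dProj_mfderiv_cotangentLift (f : M₁ ≃ₘ^∞⟮𝓘(ℝ, E₁), 𝓘(ℝ, E₂)⟯ M₂)
    (ξ : CotangentBundle E₁ M₁) (V : TangentSpace (cotangentModel E₁) ξ) :
    dProj (cotangentLift f ξ) (mfderiv (cotangentModel E₁) (cotangentModel E₂) (cotangentLift f) ξ V)
      = mfderiv 𝓘(ℝ, E₁) 𝓘(ℝ, E₂) f ξ.proj (dProj ξ V) := by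
  have h1 : HasMFDerivAt (cotangentModel E₁) 𝓘(ℝ, E₂)
      ((fun η : CotangentBundle E₂ M₂ ↦ η.proj) ∘ cotangentLift f) ξ
      (dProj (cotangentLift f ξ) ∘L
        mfderiv (cotangentModel E₁) (cotangentModel E₂) (cotangentLift f) ξ) :=
    (mdifferentiable_proj _).hasMFDerivAt.comp ξ
      ((contMDiff_cotangentLift f).mdifferentiable (by simp) ξ).hasMFDerivAt
  have h2 : HasMFDerivAt (cotangentModel E₁) 𝓘(ℝ, E₂)
      (f ∘ fun η : CotangentBundle E₁ M₁ ↦ η.proj) ξ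
      (mfderiv 𝓘(ℝ, E₁) 𝓘(ℝ, E₂) f ξ.proj ∘L dProj ξ) :=
    (f.mdifferentiable (by simp) ξ.proj).hasMFDerivAt.comp ξ (mdifferentiable_proj ξ).hasMFDerivAt
  exact congr($(hasMFDerivAt_unique h1 h2) V)

/-- The lift covers `f`, so `dπ` turns its derivative into `df`; after `df` has been moved past
`A₂`, it cancels against the `(df)⁻¹` in the lifted covector. -/
lemma theta₁_cotangentLift (f : M₁ ≃ₘ^∞⟮𝓘(ℝ, E₁), 𝓘(ℝ, E₂)⟯ M₂)
    {A₁ : ∀ x : M₁, TangentSpace 𝓘(ℝ, E₁) x →L[ℝ] TangentSpace 𝓘(ℝ, E₁) x}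
    {A₂ : ∀ x : M₂, TangentSpace 𝓘(ℝ, E₂) x →L[ℝ] TangentSpace 𝓘(ℝ, E₂) x}
    (h : ∀ x : M₁, A₂ (f x) ∘L mfderiv 𝓘(ℝ, E₁) 𝓘(ℝ, E₂) f x =
      mfderiv 𝓘(ℝ, E₁) 𝓘(ℝ, E₂) f x ∘L A₁ x) :
    (fun ξ ↦ theta₁ A₂ (cotangentLift f ξ) ∘L
      mfderiv (cotangentModel E₁) (cotangentModel E₂) (cotangentLift f) ξ) = theta₁ A₁ := by
  funext ξ
  refine ContinuousLinearMap.ext fun V ↦ ?_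
  have h1 : A₂ (f ξ.proj) (dProj (cotangentLift f ξ)
      (mfderiv (cotangentModel E₁) (cotangentModel E₂) (cotangentLift f) ξ V)) =
      mfderiv 𝓘(ℝ, E₁) 𝓘(ℝ, E₂) f ξ.proj (A₁ ξ.proj (dProj ξ V)) :=
    congr(A₂ (f ξ.proj) $(dProj_mfderiv_cotangentLift f ξ V)).trans congr($(h ξ.proj) (dProj ξ V))
  exact congr(covector (cotangentLift f ξ) $h1).trans (covector_cotangentLift_mfderiv f ξ _)

/-- The Liouville form is `θ(Id)`, and `df` always intertwines identities. -/
lemma liouville_cotangentLift (f : M₁ ≃ₘ^∞⟮𝓘(ℝ, E₁), 𝓘(ℝ, E₂)⟯ M₂) :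
    (fun ξ ↦ liouville (cotangentLift f ξ) ∘L
      mfderiv (cotangentModel E₁) (cotangentModel E₂) (cotangentLift f) ξ) =
      (liouville (E := E₁) (M := M₁)) :=
  theta₁_cotangentLift f (A₁ := fun _ ↦ .id ℝ _) (A₂ := fun _ ↦ .id ℝ _) fun _ ↦ rfl

lemma extDerivOne_cotangentLift (f : M₁ ≃ₘ^∞⟮𝓘(ℝ, E₁), 𝓘(ℝ, E₂)⟯ M₂)
    {α : ∀ ξ : CotangentBundle E₁ M₁, TangentSpace (cotangentModel E₁) ξ →L[ℝ] ℝ}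
    {β : ∀ η : CotangentBundle E₂ M₂, TangentSpace (cotangentModel E₂) η →L[ℝ] ℝ}
    (h : (fun ξ ↦ β (cotangentLift f ξ) ∘L
      mfderiv (cotangentModel E₁) (cotangentModel E₂) (cotangentLift f) ξ) = α)
    (ξ : CotangentBundle E₁ M₁)
    (hβ : DifferentiableAt ℝ (chartForm (cotangentModel E₂) β (cotangentLift f ξ))
      (extChartAt (cotangentModel E₂) (cotangentLift f ξ) (cotangentLift f ξ)))
    (V W : TangentSpace (cotangentModel E₁) ξ) :
    extDerivOne (cotangentModel E₂) β (cotangentLift f ξ)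
        (mfderiv (cotangentModel E₁) (cotangentModel E₂) (cotangentLift f) ξ V)
        (mfderiv (cotangentModel E₁) (cotangentModel E₂) (cotangentLift f) ξ W) =
      extDerivOne (cotangentModel E₁) α ξ V W := by
  have : IsManifold (cotangentModel E₁) 2 (CotangentBundle E₁ M₁) := .of_le (n := ∞) two_le_infty
  have : IsManifold (cotangentModel E₂) 2 (CotangentBundle E₂ M₂) := .of_le (n := ∞) two_le_infty
  rw [← h]
  exact (extDerivOne_pullback ((contMDiff_cotangentLift f ξ).of_le two_le_infty) β hβ V W).symm

lemma omegaSt_cotangentLift (f : M₁ ≃ₘ^∞⟮𝓘(ℝ, E₁), 𝓘(ℝ, E₂)⟯ M₂) (ξ : CotangentBundle E₁ M₁)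
    (V W : TangentSpace (cotangentModel E₁) ξ) :
    omegaSt (cotangentLift f ξ)
        (mfderiv (cotangentModel E₁) (cotangentModel E₂) (cotangentLift f) ξ V)
        (mfderiv (cotangentModel E₁) (cotangentModel E₂) (cotangentLift f) ξ W) =
      omegaSt ξ V W := by
  refine extDerivOne_cotangentLift f (liouville_cotangentLift f) ξ ?_ V W
  exact (hasFDerivAt_snd_comp_field_comp_fst (B := fun _ ↦ .id ℝ E₂) (differentiableAt_const _)
    (Filter.eventually_of_mem (extChartAt_target_mem_nhds _) fun y hy ↦
      chartForm_liouville (cotangentLift f ξ) hy)).1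

variable [FiniteDimensional ℝ E₁] [FiniteDimensional ℝ E₂]

/-- A map preserving a nondegenerate form is injective, and the two tangent spaces have equal
dimension because `df` identifies `E₁` with `E₂`. -/
lemma mfderiv_cotangentLift_surjective (f : M₁ ≃ₘ^∞⟮𝓘(ℝ, E₁), 𝓘(ℝ, E₂)⟯ M₂)
    (ξ : CotangentBundle E₁ M₁) : Function.Surjective
      (mfderiv (cotangentModel E₁) (cotangentModel E₂) (cotangentLift f) ξ) := by
  let e : E₁ ≃L[ℝ] E₂ := f.mfderivToContinuousLinearEquiv (by simp) ξ.proj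
  have : FiniteDimensional ℝ (TangentSpace (cotangentModel E₁) ξ) :=
    inferInstanceAs (FiniteDimensional ℝ (E₁ × (E₁ →L[ℝ] ℝ)))
  have : FiniteDimensional ℝ (TangentSpace (cotangentModel E₂) (cotangentLift f ξ)) :=
    inferInstanceAs (FiniteDimensional ℝ (E₂ × (E₂ →L[ℝ] ℝ)))
  have hdim : Module.finrank ℝ (TangentSpace (cotangentModel E₁) ξ) =
      Module.finrank ℝ (TangentSpace (cotangentModel E₂) (cotangentLift f ξ)) :=
    (e.prodCongr (e.arrowCongr (.refl ℝ ℝ))).toLinearEquiv.finrank_eq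
  refine (LinearMap.injective_iff_surjective_of_finrank_eq_finrank
    (f := (mfderiv (cotangentModel E₁) (cotangentModel E₂) (cotangentLift f) ξ).toLinearMap)
    hdim).1 ?_
  rw [injective_iff_map_eq_zero]
  intro V hV
  obtain ⟨w, hw⟩ := omegaSt_isInvertible ξ
  apply w.injective
  rw [map_zero]
  refine ContinuousLinearMap.ext fun W ↦ ?_
  have h1 : omegaSt ξ V W = 0 := by
    rw [← omegaSt_cotangentLift f ξ V W]
    exact congr(omegaSt (cotangentLift f ξ) $hV _).trans
      congr($((omegaSt (cotangentLift f ξ)).map_zero) _)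
  rw [← hw] at h1
  exact h1

/-- The common core of both parts. Holomorphy of `f` is read off from `dπ`; once it holds, the terms
`d(θ(A))` match under the lift and only the terms `θ(R)` are left to compare. -/
lemma isHolomorphic_cotangentLift_iff (f : M₁ ≃ₘ^∞⟮𝓘(ℝ, E₁), 𝓘(ℝ, E₂)⟯ M₂)
    {A₁ : ∀ x : M₁, TangentSpace 𝓘(ℝ, E₁) x →L[ℝ] TangentSpace 𝓘(ℝ, E₁) x}
    {A₂ : ∀ x : M₂, TangentSpace 𝓘(ℝ, E₂) x →L[ℝ] TangentSpace 𝓘(ℝ, E₂) x}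
    (hA₁ : ContMDiff 𝓘(ℝ, E₁) (𝓘(ℝ, E₁).prod 𝓘(ℝ, E₁ →L[ℝ] E₁)) ∞
      (fun x : M₁ ↦ TotalSpace.mk' (E₁ →L[ℝ] E₁)
        (E := fun x : M₁ ↦ TangentSpace 𝓘(ℝ, E₁) x →L[ℝ] TangentSpace 𝓘(ℝ, E₁) x) x (A₁ x)))
    (hA₂ : ContMDiff 𝓘(ℝ, E₂) (𝓘(ℝ, E₂).prod 𝓘(ℝ, E₂ →L[ℝ] E₂)) ∞
      (fun x : M₂ ↦ TotalSpace.mk' (E₂ →L[ℝ] E₂)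
        (E := fun x : M₂ ↦ TangentSpace 𝓘(ℝ, E₂) x →L[ℝ] TangentSpace 𝓘(ℝ, E₂) x) x (A₂ x)))
    (R₁ : ∀ x : M₁, TangentSpace 𝓘(ℝ, E₁) x →L[ℝ]
      TangentSpace 𝓘(ℝ, E₁) x →L[ℝ] TangentSpace 𝓘(ℝ, E₁) x)
    (R₂ : ∀ y : M₂, TangentSpace 𝓘(ℝ, E₂) y →L[ℝ]
      TangentSpace 𝓘(ℝ, E₂) y →L[ℝ] TangentSpace 𝓘(ℝ, E₂) y) :
    IsHolomorphic (cotangentModel E₁) (cotangentModel E₂)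
        (fun ξ ↦ omegaSolve ξ (extDerivOne (cotangentModel E₁) (theta₁ A₁) ξ + theta₂ R₁ ξ))
        (fun ξ ↦ omegaSolve ξ (extDerivOne (cotangentModel E₂) (theta₁ A₂) ξ + theta₂ R₂ ξ))
        (cotangentLift f) ↔
      IsHolomorphic 𝓘(ℝ, E₁) 𝓘(ℝ, E₂) A₁ A₂ f ∧ ∀ y, pushTensor f R₁ y = R₂ y := by
  have hω : (∀ x : M₁, A₂ (f x) ∘L mfderiv 𝓘(ℝ, E₁) 𝓘(ℝ, E₂) f x =
      mfderiv 𝓘(ℝ, E₁) 𝓘(ℝ, E₂) f x ∘L A₁ x) → ∀ (ξ : CotangentBundle E₁ M₁)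
      (V W : TangentSpace (cotangentModel E₁) ξ),
      extDerivOne (cotangentModel E₂) (theta₁ A₂) (cotangentLift f ξ)
        (mfderiv (cotangentModel E₁) (cotangentModel E₂) (cotangentLift f) ξ V)
        (mfderiv (cotangentModel E₁) (cotangentModel E₂) (cotangentLift f) ξ W) =
      extDerivOne (cotangentModel E₁) (theta₁ A₁) ξ V W := fun h ξ V W ↦
    extDerivOne_cotangentLift f (theta₁_cotangentLift f h) ξ
      (differentiableAt_chartForm_theta₁ (hA₂ (cotangentLift f ξ).proj)).1 V W
  rw [pushTensor_eq_iff]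
  constructor
  · rintro ⟨-, h⟩
    have hol : ∀ x : M₁, A₂ (f x) ∘L mfderiv 𝓘(ℝ, E₁) 𝓘(ℝ, E₂) f x =
        mfderiv 𝓘(ℝ, E₁) 𝓘(ℝ, E₂) f x ∘L A₁ x := by
      intro x
      refine ContinuousLinearMap.ext fun u ↦ ?_
      -- Any covector over `x` would do, since only the projection of the equation to the base is
      -- used.
      let ξ : CotangentBundle E₁ M₁ := ⟨x, 0⟩
      obtain ⟨V, hV⟩ := dProj_surjective ξ u
      have h1 := congr(dProj (cotangentLift f ξ) ($(h ξ) V))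
      rw [ContinuousLinearMap.comp_apply, ContinuousLinearMap.comp_apply,
        dProj_omegaSolve_extDerivOne_add_theta₂ (hA₂ _), dProj_mfderiv_cotangentLift,
        dProj_mfderiv_cotangentLift, dProj_omegaSolve_extDerivOne_add_theta₂ (hA₁ _), hV] at h1
      exact h1
    refine ⟨⟨f.mdifferentiable (by simp), hol⟩, fun x u v ↦ ?_⟩
    refine sub_eq_zero.1 (SeparatingDual.eq_zero_of_forall_dual_eq_zero (R := ℝ) (V := E₂)
      fun g ↦ ?_)
    -- Chosen as `g ∘ df` so that its lift is the given form `g` at `f x`.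
    let ξ : CotangentBundle E₁ M₁ :=
      ⟨x, (g ∘L (mfderiv 𝓘(ℝ, E₁) 𝓘(ℝ, E₂) f x : E₁ →L[ℝ] E₂) : E₁ →L[ℝ] ℝ)⟩
    have hg : ∀ w : TangentSpace 𝓘(ℝ, E₂) (f x), covector (cotangentLift f ξ) w = g w := by
      intro w
      obtain ⟨w, rfl⟩ := (f.mfderivToContinuousLinearEquiv (by simp) x).surjective w
      exact covector_cotangentLift_mfderiv f ξ w
    obtain ⟨V, hV⟩ := dProj_surjective ξ u
    obtain ⟨W, hW⟩ := dProj_surjective ξ v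
    have h1 := congr(omegaSt (cotangentLift f ξ) ($(h ξ) V)
      (mfderiv (cotangentModel E₁) (cotangentModel E₂) (cotangentLift f) ξ W))
    rw [ContinuousLinearMap.comp_apply, ContinuousLinearMap.comp_apply, omegaSt_omegaSolve,
      omegaSt_cotangentLift, omegaSt_omegaSolve, add_apply, add_apply, add_apply, add_apply,
      hω hol, add_right_inj, theta₂_apply, theta₂_apply, dProj_mfderiv_cotangentLift,
      dProj_mfderiv_cotangentLift, hV, hW] at h1
    refine (g.map_sub _ _).trans (sub_eq_zero.2 ?_)
    exact (hg _).symm.trans (h1.trans rfl)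
  · rintro ⟨⟨-, hol⟩, hR⟩
    refine ⟨(contMDiff_cotangentLift f).mdifferentiable (by simp), fun ξ ↦ ?_⟩
    refine ContinuousLinearMap.ext fun V ↦ ?_
    obtain ⟨w, hw⟩ := omegaSt_isInvertible (cotangentLift f ξ)
    apply w.injective
    rw [← ContinuousLinearEquiv.coe_coe, hw]
    refine ContinuousLinearMap.ext fun W ↦ ?_
    -- Invariance of the forms is known only on vectors in the image of the derivative of the lift;
    -- surjectivity makes these all test vectors.
    obtain ⟨W, rfl⟩ := mfderiv_cotangentLift_surjective f ξ W
    have h1 := congr(covector (cotangentLift f ξ) $(hR ξ.proj (dProj ξ V) (dProj ξ W))).trans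
      (covector_cotangentLift_mfderiv f ξ _)
    rw [← dProj_mfderiv_cotangentLift, ← dProj_mfderiv_cotangentLift] at h1
    have h2 := congr($(hω hol ξ V W) + $h1)
    have h3 := omegaSt_omegaSolve ξ
      (extDerivOne (cotangentModel E₁) (theta₁ A₁) ξ + theta₂ R₁ ξ) V W
    have h4 := omegaSt_omegaSolve (cotangentLift f ξ)
      (extDerivOne (cotangentModel E₂) (theta₁ A₂) (cotangentLift f ξ) +
        theta₂ R₂ (cotangentLift f ξ))
      (mfderiv (cotangentModel E₁) (cotangentModel E₂) (cotangentLift f) ξ V)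
      (mfderiv (cotangentModel E₁) (cotangentModel E₂) (cotangentLift f) ξ W)
    exact h4.trans (h2.trans (h3.symm.trans (omegaSt_cotangentLift f ξ _ W).symm))

/-! ### Naturality of the Nijenhuis tensor -/

/-- Pulling back vector fields by `f` commutes with Lie brackets and, by holomorphy, exchanges `J₂`
with `J₁`. Thus each of the four terms of the tensor corresponds to its counterpart. -/
lemma nijenhuis_mfderiv {J₁ : AlmostComplexStructure E₁ M₁} {J₂ : AlmostComplexStructure E₂ M₂}
    (f : M₁ ≃ₘ^∞⟮𝓘(ℝ, E₁), 𝓘(ℝ, E₂)⟯ M₂)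
    (hf : IsHolomorphic 𝓘(ℝ, E₁) 𝓘(ℝ, E₂) J₁.toFun J₂.toFun f) (x : M₁)
    (u v : TangentSpace 𝓘(ℝ, E₁) x) :
    nijenhuis J₂ (f x) (mfderiv 𝓘(ℝ, E₁) 𝓘(ℝ, E₂) f x u) (mfderiv 𝓘(ℝ, E₁) 𝓘(ℝ, E₂) f x v) =
      mfderiv 𝓘(ℝ, E₁) 𝓘(ℝ, E₂) f x (nijenhuis J₁ x u v) := by
  have hinv : ∀ z, (mfderiv 𝓘(ℝ, E₁) 𝓘(ℝ, E₂) f z).IsInvertible := fun z ↦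
    ⟨f.mfderivToContinuousLinearEquiv (by simp) z, rfl⟩
  have hJ : ∀ X : ∀ y : M₂, TangentSpace 𝓘(ℝ, E₂) y,
      mpullback 𝓘(ℝ, E₁) 𝓘(ℝ, E₂) f (fun y ↦ J₂.toFun y (X y)) =
        fun z ↦ J₁.toFun z (mpullback 𝓘(ℝ, E₁) 𝓘(ℝ, E₂) f X z) := by
    intro X
    funext z
    rw [mpullback_apply, mpullback_apply]
    obtain ⟨e, he⟩ := hinv z
    have h1 := congr($(hf.2 z) (e.symm (X (f z))))
    rw [← he, ContinuousLinearMap.inverse_equiv]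
    rw [← he] at h1
    apply e.injective
    refine (e.apply_symm_apply _).trans ?_
    refine Eq.trans ?_ h1
    exact congr(J₂.toFun (f z) $((e.apply_symm_apply (X (f z))).symm))
  set X := FiberBundle.extend E₂ (mfderiv 𝓘(ℝ, E₁) 𝓘(ℝ, E₂) f x u) with hX
  set Y := FiberBundle.extend E₂ (mfderiv 𝓘(ℝ, E₁) 𝓘(ℝ, E₂) f x v) with hY
  have : IsManifold 𝓘(ℝ, E₁) 2 M₁ := .of_le (n := ∞) two_le_infty
  have : IsManifold 𝓘(ℝ, E₂) 2 M₂ := .of_le (n := ∞) two_le_infty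
  have : IsManifold 𝓘(ℝ, E₁) (minSmoothness ℝ 2) M₁ := by simpa
  have : IsManifold 𝓘(ℝ, E₂) (minSmoothness ℝ 2) M₂ := by simpa
  have hXd : MDiffAt (T% X) (f x) := FiberBundle.mdifferentiableAt_extend ..
  have hYd : MDiffAt (T% Y) (f x) := FiberBundle.mdifferentiableAt_extend ..
  have hfx : ContMDiffAt 𝓘(ℝ, E₁) 𝓘(ℝ, E₂) ∞ f x := f.contMDiff x
  have hpull : ∀ w : TangentSpace 𝓘(ℝ, E₁) x, mpullback 𝓘(ℝ, E₁) 𝓘(ℝ, E₂) f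
      (FiberBundle.extend E₂ (mfderiv 𝓘(ℝ, E₁) 𝓘(ℝ, E₂) f x w)) x = w := by
    intro w
    obtain ⟨e, he⟩ := hinv x
    rw [mpullback_apply, FiberBundle.extend_apply_self, ← he, ContinuousLinearMap.inverse_equiv]
    exact e.symm_apply_apply w
  have hN₂ : nijenhuis J₂ (f x) (mfderiv 𝓘(ℝ, E₁) 𝓘(ℝ, E₂) f x u)
      (mfderiv 𝓘(ℝ, E₁) 𝓘(ℝ, E₂) f x v) = nijenhuisAux J₂ X Y (f x) := rfl
  -- The pulled-back fields need not be the extensions of `u`, `v` used to define the tensor;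
  -- tensoriality allows any fields differentiable at `x` with these values.
  have hN₁ : nijenhuis J₁ x u v = nijenhuisAux J₁ (mpullback 𝓘(ℝ, E₁) 𝓘(ℝ, E₂) f X)
      (mpullback 𝓘(ℝ, E₁) 𝓘(ℝ, E₂) f Y) x := by
    have h := TensorialAt.mkHom₂_apply (Φ := (nijenhuisAux J₁ · · x))
      (fun Y _ ↦ nijenhuisAux_tensorial_left J₁ x Y) (fun X _ ↦ nijenhuisAux_tensorial_right J₁ x X)
      (hXd.mpullback_vectorField hfx (hinv x) two_le_infty)
      (hYd.mpullback_vectorField hfx (hinv x) two_le_infty)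
    rw [hpull, hpull] at h
    exact h
  have hb : ∀ {X Y : ∀ y : M₂, TangentSpace 𝓘(ℝ, E₂) y}, MDiffAt (T% X) (f x) →
      MDiffAt (T% Y) (f x) → mlieBracket 𝓘(ℝ, E₁) (mpullback 𝓘(ℝ, E₁) 𝓘(ℝ, E₂) f X)
        (mpullback 𝓘(ℝ, E₁) 𝓘(ℝ, E₂) f Y) x =
      mpullback 𝓘(ℝ, E₁) 𝓘(ℝ, E₂) f (mlieBracket 𝓘(ℝ, E₂) X Y) x := fun hX hY ↦
    (mpullback_mlieBracket hX hY hfx (by simpa using two_le_infty)).symm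
  have hJ' : ∀ w : TangentSpace 𝓘(ℝ, E₁) x, mfderiv 𝓘(ℝ, E₁) 𝓘(ℝ, E₂) f x (J₁.toFun x w) =
      J₂.toFun (f x) (mfderiv 𝓘(ℝ, E₁) 𝓘(ℝ, E₂) f x w) := fun w ↦ congr($(hf.2 x) w).symm
  have hd : ∀ Z : ∀ y : M₂, TangentSpace 𝓘(ℝ, E₂) y, mfderiv 𝓘(ℝ, E₁) 𝓘(ℝ, E₂) f x
      (mpullback 𝓘(ℝ, E₁) 𝓘(ℝ, E₂) f Z x) = Z (f x) := by
    intro Z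
    obtain ⟨e, he⟩ := hinv x
    rw [mpullback_apply, ← he, ContinuousLinearMap.inverse_equiv]
    exact e.apply_symm_apply _
  rw [hN₂, hN₁, nijenhuisAux, nijenhuisAux, ← hJ, ← hJ, hb hXd hYd, hb (J₂.mdiffAt hXd) hYd,
    hb hXd (J₂.mdiffAt hYd), hb (J₂.mdiffAt hXd) (J₂.mdiffAt hYd), map_sub, map_sub, map_sub,
    hJ', hJ', hd, hd, hd, hd]

/-- Duality by `ω_st` is linear, so the factor `-½` is absorbed into the tensor. -/
lemma completeLift_eq {E : Type*} [NormedAddCommGroup E] [NormedSpace ℝ E]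
    [FiniteDimensional ℝ E] {M : Type*} [TopologicalSpace M] [ChartedSpace E M]
    [IsManifold 𝓘(ℝ, E) ∞ M] (J : AlmostComplexStructure E M) :
    completeLift J = fun ξ ↦ omegaSolve ξ (extDerivOne (cotangentModel E) (theta₁ J.toFun) ξ +
      theta₂ (fun x ↦ (-(1 / 2) : ℝ) • complexNijenhuis J x) ξ) := by
  funext ξ
  refine ContinuousLinearMap.ext fun V ↦ ?_
  have h : theta₂ (fun x ↦ (-(1 / 2) : ℝ) • complexNijenhuis J x) ξ V =
      (-(1 / 2) : ℝ) • theta₂ (complexNijenhuis J) ξ V := by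
    refine ContinuousLinearMap.ext fun W ↦ ?_
    exact map_smul (covector ξ) _ _
  have h1 := (omegaSt ξ).inverse.map_add
    (extDerivOne (cotangentModel E) (theta₁ J.toFun) ξ V)
    ((-(1 / 2) : ℝ) • theta₂ (complexNijenhuis J) ξ V)
  have h2 := (omegaSt ξ).inverse.map_smul (-(1 / 2) : ℝ) (theta₂ (complexNijenhuis J) ξ V)
  simp only [completeLift, basicLift, gamma, omegaSolve, ContinuousLinearMap.comp_apply,
    add_apply, sub_apply, smul_apply, h]
  rw [h1, h2]
  module

lemma horizontalLift_eq {E : Type*} [NormedAddCommGroup E] [NormedSpace ℝ E]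
    [FiniteDimensional ℝ E] {M : Type*} [TopologicalSpace M] [ChartedSpace E M]
    [IsManifold 𝓘(ℝ, E) ∞ M] (J : AlmostComplexStructure E M) (D : Connection E M) :
    horizontalLift J D = fun ξ ↦ omegaSolve ξ
      (extDerivOne (cotangentModel E) (theta₁ J.toFun) ξ +
        theta₂ (bracketJ (symmetrized D) J) ξ) := by
  funext ξ
  rw [horizontalLift, basicLift, gamma, omegaSolve, omegaSolve, omegaSolve,
    ContinuousLinearMap.comp_add]

end

end AlmostComplex

end

theorem corollary2
    {E₁ : Type*} [NormedAddCommGroup E₁] [NormedSpace ℝ E₁] [FiniteDimensional ℝ E₁]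
    {E₂ : Type*} [NormedAddCommGroup E₂] [NormedSpace ℝ E₂] [FiniteDimensional ℝ E₂]
    {M₁ : Type*} [TopologicalSpace M₁] [ChartedSpace E₁ M₁] [IsManifold 𝓘(ℝ, E₁) ∞ M₁]
    {M₂ : Type*} [TopologicalSpace M₂] [ChartedSpace E₂ M₂] [IsManifold 𝓘(ℝ, E₂) ∞ M₂]
    (J₁ : AlmostComplexStructure E₁ M₁) (J₂ : AlmostComplexStructure E₂ M₂)
    (f : M₁ ≃ₘ^∞⟮𝓘(ℝ, E₁), 𝓘(ℝ, E₂)⟯ M₂) :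
    (IsHolomorphic (cotangentModel E₁) (cotangentModel E₂)
        (completeLift J₁) (completeLift J₂) (cotangentLift f) ↔
      IsHolomorphic 𝓘(ℝ, E₁) 𝓘(ℝ, E₂) J₁.toFun J₂.toFun f) ∧
    ∀ (D₁ : Connection E₁ M₁) (D₂ : Connection E₂ M₂)
      [D₁.ContMDiffCovariantDerivative ∞] [D₂.ContMDiffCovariantDerivative ∞],
      IsHolomorphic (cotangentModel E₁) (cotangentModel E₂)
          (horizontalLift J₁ D₁) (horizontalLift J₂ D₂) (cotangentLift f) ↔
        IsHolomorphic 𝓘(ℝ, E₁) 𝓘(ℝ, E₂) J₁.toFun J₂.toFun f ∧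
          ∀ y : M₂, pushTensor f (bracketJ (symmetrized D₁) J₁) y =
            bracketJ (symmetrized D₂) J₂ y := by
  constructor
  · rw [completeLift_eq, completeLift_eq,
      isHolomorphic_cotangentLift_iff f J₁.smooth J₂.smooth, pushTensor_eq_iff]
    -- The tensor condition follows from holomorphy: `df` carries `N_{J₁}` to `N_{J₂}` and commutes
    -- with the outer `J`.
    refine and_iff_left_of_imp fun hf x u v ↦ ?_
    have h := congr((-(1 / 2) : ℝ) • J₂.toFun (f x) $(nijenhuis_mfderiv f hf x u v))
    refine h.trans ?_
    have h1 := congr($(hf.2 x) (nijenhuis J₁ x u v))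
    exact congr((-(1 / 2) : ℝ) • $h1).trans
      ((mfderiv 𝓘(ℝ, E₁) 𝓘(ℝ, E₂) f x).map_smul _ _).symm
  · intro D₁ D₂ _ _
    rw [horizontalLift_eq, horizontalLift_eq,
      isHolomorphic_cotangentLift_iff f J₁.smooth J₂.smooth]
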